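/- Let $G$ be a connected (finite or infinite) simple graph all of whose vertex degrees are at most $D$, and let $(w_f)_{f\in E(G)}$ be i.i.d. exponential random variables with mean $1$. For an edge $e=(uv)$ of $G$ and an integer $r\ge 0$, let $\mathbb{B}_e^r(G)$ be the subgraph of $G$ induced by all vertices whose graph distance from $u$ or from $v$ is at most $r$. For a subgraph $H$ of $G$ let $\partial H$ be the set of vertices of $H$ that have a $G$-neighbour outside $V(H)$, and for $A\subseteq V(G)$ let $H\setminus A$ be the graph obtained from $H$ by deleting the vertices of $A$. For a finite subgraph $H$ let $\mathcal{M}_H$ be the matching of $H$ (a set of edges of $H$, no two sharing a vertex) that maximizes the total weight $\sum_{f\in M}w_f$ over all matchings $M$ of $H$. Put \[ \varrho_r(G,e):=\mathbf{E}\sup_{A\subseteq\partial\mathbb{B}_e^r(G)}\bigl|\mathbf{1}_{\{e\in\mathcal{M}_{\mathbb{B}_e^r(G)}\}}-\mathbf{1}_{\{e\in\mathcal{M}_{\mathbb{B}_e^r(G)\setminus A}\}}\bigr| . \] Let $e\in E(G)$ and $r\ge 3$ be such that $\mathbb{B}_e^r(G)$ is a tree. Then $\varrho_r(G,e)$ is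 well defined (almost surely, the maximum weight matching of $\mathbb{B}_e^r(G)\setminus A$ exists and is unique for every $A\subseteq\partial\mathbb{B}_e^r(G)$, and the supremum is an integrable random variable), and \[ \varrho_r(G,e)\le 2D\bigl(1-(2D)^{-D}\bigr)^{r-2}. \] -/

import Mathlib

open MeasureTheory ProbabilityTheory

namespace MWM

variable {V : Type*} {G : SimpleGraph V}

/-- The ball of radius `r` around the edge `e`: the subgraph of `G` induced by all vertices whose
graph distance to one of the two endpoints of `e` is at most `r`. -/
def edgeBall (G : SimpleGraph V) (e : G.edgeSet) (r : ℕ) : G.Subgraph :=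
  (⊤ : G.Subgraph).induce {x | ∃ y ∈ (e : Sym2 V), G.edist y x ≤ (r : ℕ∞)}

/-- The vertex boundary of a subgraph `H` of `G`: the vertices of `H` that have a `G`-neighbour
outside `H`. -/
def boundary (H : G.Subgraph) : Set V :=
  {v | v ∈ H.verts ∧ ∃ u, u ∉ H.verts ∧ G.Adj v u}

/-- `M` is a (finite) matching of the subgraph `H`: a set of edges of `H`, no two of which share
a vertex. If `H` is finite, every matching is finite. -/
def IsMatchingOf (H : G.Subgraph) (M : Finset G.edgeSet) : Prop :=
  (∀ e ∈ M, (e : Sym2 V) ∈ H.edgeSet) ∧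
    ∀ e ∈ M, ∀ f ∈ M, ∀ x : V, x ∈ (e : Sym2 V) → x ∈ (f : Sym2 V) → e = f

/-- The weight of a finite set of edges. -/
def weight (w : G.edgeSet → ℝ) (M : Finset G.edgeSet) : ℝ :=
  ∑ e ∈ M, w e

/-- `M` is a matching of `H` of maximum weight. -/
def IsMaxWeightMatching (w : G.edgeSet → ℝ) (H : G.Subgraph) (M : Finset G.edgeSet) : Prop :=
  IsMatchingOf H M ∧ ∀ M' : Finset G.edgeSet, IsMatchingOf H M' → weight w M' ≤ weight w M

/-- The maximum weight matching of `H` (chosen arbitrarily in case of ties). -/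
noncomputable def maxWeightMatching (w : G.edgeSet → ℝ) (H : G.Subgraph) : Finset G.edgeSet :=
  Classical.epsilon (IsMaxWeightMatching w H)

/-- The indicator that the edge `e` belongs to the maximum weight matching of `H`. -/
noncomputable def matchedIndicator (w : G.edgeSet → ℝ) (H : G.Subgraph) (e : G.edgeSet) : ℝ :=
  Set.indicator (maxWeightMatching w H : Set G.edgeSet) (fun _ => (1 : ℝ)) e

/-- The worst-case change of the indicator of `e` being in the maximum weight matching of the ball
of radius `r` around `e`, when a set `A` of boundary vertices of the ball is deleted. -/
noncomputable def boundaryInfluence (w : G.edgeSet → ℝ) (e : G.edgeSet) (r : ℕ) : ℝ :=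
  ⨆ A : {A : Set V // A ⊆ boundary (edgeBall G e r)},
    |matchedIndicator w (edgeBall G e r) e
      - matchedIndicator w ((edgeBall G e r).deleteVerts A) e|

/-- The correlation-decay quantity `ϱ_r(G, e)`: the expectation of `boundaryInfluence` for the
random edge weights `w`. -/
noncomputable def corrDecay {Ω : Type*} [MeasurableSpace Ω] (P : Measure Ω)
    (w : G.edgeSet → Ω → ℝ) (e : G.edgeSet) (r : ℕ) : ℝ :=
  ∫ ω, boundaryInfluence (fun f => w f ω) e r ∂P

end MWM

open scoped NNReal

namespace MWM

variable {V : Type*} {G : SimpleGraph V}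


/-! Let g(S, x) be the loss in maximum matching weight when x is removed from S (`vertexGain`).
Matching x to its best partner gives g(S, x) = max(0, max_y (w_xy - g(S \ {x}, y))), y ranging over
the neighbours of x in S. In a ball that is a tree hanging from the edge uv, running this antitone
recursion for finitely many generations from trivial values gives lower and upper bounds
(`gainBound`, `gainBound_le_vertexGain_le`). Deletions only affect vertices of depth at least r, so
the bounds are the same for every A. Hence the status of uv can depend on A only if w_uv lies in the
window between the sum of the two lower bounds and the sum of the two upper bounds
(`edge_mem_of_gainBound`).

The weight w_uv is exponential and independent of the bounds, so P(w_uv > Z) = E exp(-Z), and the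
window has probability equal to a difference of products of Laplace transforms at 1. Independence of
the branches turns the recursion for the gains into the deterministic one f(a) = ∫₀¹ ∏ (1 - s aᵢ) ds
(`integral_exp_neg_sup`, `gainTransform_succ`).

This f is antitone, and f(a) ≥ (t + (1 - t) c) f(t a) with c = (2D)^(-D): rescaling s identifies t
f(t a) with the part of the integral over [0, t], and the part over [t, 1] is at least (1 - t) c. So
if the transforms of the two bounds have ratio at least t, then one generation later the ratio is at
least t + (1 - t) c, and its distance to 1 shrinks by the factor 1 - c
(`gainTransform_contraction`). Leaves, whose transform is exactly 1, need the variant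
`laplaceStep_contraction_of_mem`. Multiplying the ratios at u and v costs a factor 2
(`measureReal_window_le`). -/

/-! ### Matchings inside a vertex set and the gain of a vertex. -/

/-- `M` is a matching all of whose edges have both endpoints in `S`. -/
def IsMatchingIn (S : Set V) (M : Finset G.edgeSet) : Prop :=
  (∀ e ∈ M, ∀ x ∈ (e : Sym2 V), x ∈ S) ∧
    ∀ e ∈ M, ∀ f ∈ M, ∀ x : V, x ∈ (e : Sym2 V) → x ∈ (f : Sym2 V) → e = f

/-- The maximum weight of a matching inside the vertex set `S`. -/
noncomputable def maxWeight (w : G.edgeSet → ℝ) (S : Set V) : ℝ :=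
  sSup (weight w '' {M | IsMatchingIn S M})

/-- The gain in maximum weight of a matching inside `S` due to the vertex `x`. -/
noncomputable def vertexGain (w : G.edgeSet → ℝ) (S : Set V) (x : V) : ℝ :=
  maxWeight w S - maxWeight w (S \ {x})

/-- The edge weights as a function of pairs of vertices, truncated to nonnegative values. -/
noncomputable def pairWeight (w : G.edgeSet → ℝ) (x y : V) : ℝ≥0 :=
  open Classical in if h : G.Adj x y then (w ⟨s(x, y), h⟩).toNNReal else 0

theorem IsMatchingIn.mono {S T : Set V} (h : S ⊆ T) {M : Finset G.edgeSet}
    (hM : IsMatchingIn S M) : IsMatchingIn T M :=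
  ⟨fun e he x hx => h (hM.1 e he x hx), hM.2⟩

theorem finite_edges_within {S : Set V} (hS : S.Finite) :
    {e : G.edgeSet | ∀ x ∈ (e : Sym2 V), x ∈ S}.Finite := by
  refine Set.Finite.of_finite_image (f := Subtype.val) ?_ Subtype.val_injective.injOn
  refine ((hS.prod hS).image fun p : V × V => s(p.1, p.2)).subset ?_
  rintro _ ⟨⟨e, he⟩, h, rfl⟩
  induction e with
  | h x y => exact ⟨(x, y), ⟨h x (by simp), h y (by simp)⟩, rfl⟩

theorem finite_matchings {S : Set V} (hS : S.Finite) :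
    {M : Finset G.edgeSet | IsMatchingIn S M}.Finite := by
  classical
  refine ((finite_edges_within (G := G) hS).toFinset.powerset.finite_toSet).subset ?_
  intro M hM
  simp only [Finset.coe_powerset, Set.mem_preimage, Set.mem_powerset_iff]
  intro e he
  simpa using hM.1 e he

theorem isMatchingIn_empty (S : Set V) : IsMatchingIn S (∅ : Finset G.edgeSet) := by
  simp [IsMatchingIn]

theorem weight_le_maxWeight (w : G.edgeSet → ℝ) {S : Set V} (hS : S.Finite)
    {M : Finset G.edgeSet} (hM : IsMatchingIn S M) : weight w M ≤ maxWeight w S :=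
  le_csSup ((finite_matchings hS).image _).bddAbove ⟨M, hM, rfl⟩

theorem exists_weight_eq_maxWeight (w : G.edgeSet → ℝ) {S : Set V} (hS : S.Finite) :
    ∃ M : Finset G.edgeSet, IsMatchingIn S M ∧ weight w M = maxWeight w S := by
  have hne : (weight w '' {M : Finset G.edgeSet | IsMatchingIn S M}).Nonempty :=
    ⟨_, ∅, isMatchingIn_empty S, rfl⟩
  obtain ⟨M, hM, h⟩ := hne.csSup_mem ((finite_matchings hS).image _)
  exact ⟨M, hM, h⟩

theorem maxWeight_mono (w : G.edgeSet → ℝ) {S T : Set V} (hT : T.Finite) (h : S ⊆ T) :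
    maxWeight w S ≤ maxWeight w T := by
  obtain ⟨M, hM, hw⟩ := exists_weight_eq_maxWeight w (hT.subset h)
  exact hw ▸ weight_le_maxWeight w hT (hM.mono h)

/-- Adding an edge to a matching avoiding its endpoints. -/
theorem IsMatchingIn.insert_edge [DecidableEq G.edgeSet] {S : Set V} {x y : V} (hx : x ∈ S)
    (hy : y ∈ S) (h : G.Adj x y) {M : Finset G.edgeSet} (hM : IsMatchingIn ((S \ {x}) \ {y}) M) :
    (⟨s(x, y), h⟩ : G.edgeSet) ∉ M ∧ IsMatchingIn S (insert ⟨s(x, y), h⟩ M) := by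
  have hdis : ∀ f ∈ M, ∀ z ∈ (f : Sym2 V), z ∉ s(x, y) := by
    intro f hf z hz hzz
    have := hM.1 f hf z hz
    simp only [Set.mem_sdiff, Set.mem_singleton_iff] at this
    simp only [Sym2.mem_iff] at hzz
    tauto
  refine ⟨fun hmem => hdis _ hmem x (by simp) (by simp), ?_, ?_⟩
  · intro f hf z hz
    rcases Finset.mem_insert.1 hf with rfl | hf
    · simp only [Sym2.mem_iff] at hz
      rcases hz with rfl | rfl <;> assumption
    · exact (hM.1 f hf z hz).1.1
  · intro f hf g hg z hzf hzg
    rcases Finset.mem_insert.1 hf with rfl | hf <;> rcases Finset.mem_insert.1 hg with rfl | hg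
    · rfl
    · exact absurd hzf (hdis g hg z hzg)
    · exact absurd hzg (hdis f hf z hzf)
    · exact hM.2 f hf g hg z hzf hzg

theorem IsMatchingIn.erase_edge [DecidableEq G.edgeSet] {S : Set V} {x y : V} (h : G.Adj x y)
    {M : Finset G.edgeSet} (hM : IsMatchingIn S M) (he : (⟨s(x, y), h⟩ : G.edgeSet) ∈ M) :
    IsMatchingIn ((S \ {x}) \ {y}) (M.erase ⟨s(x, y), h⟩) := by
  refine ⟨fun f hf z hz => ?_, fun f hf g hg z hzf hzg =>
    hM.2 f (Finset.mem_of_mem_erase hf) g (Finset.mem_of_mem_erase hg) z hzf hzg⟩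
  have hf' := Finset.mem_erase.1 hf
  refine ⟨⟨hM.1 f hf'.2 z hz, ?_⟩, ?_⟩ <;> rintro rfl
  · exact hf'.1 (hM.2 f hf'.2 _ he z hz (by simp))
  · exact hf'.1 (hM.2 f hf'.2 _ he z hz (by simp))

theorem add_maxWeight_le (w : G.edgeSet → ℝ) {S : Set V} (hS : S.Finite) {x y : V} (hx : x ∈ S)
    (hy : y ∈ S) (h : G.Adj x y) :
    w ⟨s(x, y), h⟩ + maxWeight w ((S \ {x}) \ {y}) ≤ maxWeight w S := by
  classical
  obtain ⟨M, hM, hw⟩ := exists_weight_eq_maxWeight w ((hS.sdiff (t := {x})).sdiff (t := {y}))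
  obtain ⟨hn, hI⟩ := hM.insert_edge hx hy h
  have := weight_le_maxWeight w hS hI
  rw [weight, Finset.sum_insert hn] at this
  rw [← hw]
  exact this

theorem weight_le_add_maxWeight (w : G.edgeSet → ℝ) {S : Set V} (hS : S.Finite) {x y : V}
    (h : G.Adj x y) {M : Finset G.edgeSet} (hM : IsMatchingIn S M)
    (he : (⟨s(x, y), h⟩ : G.edgeSet) ∈ M) :
    weight w M ≤ w ⟨s(x, y), h⟩ + maxWeight w ((S \ {x}) \ {y}) := by
  classical
  have := weight_le_maxWeight w ((hS.sdiff (t := {x})).sdiff (t := {y})) (hM.erase_edge h he)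
  rw [weight, ← Finset.add_sum_erase _ _ he]
  unfold weight at this
  linarith

theorem vertexGain_nonneg (w : G.edgeSet → ℝ) {S : Set V} (hS : S.Finite) (x : V) :
    0 ≤ vertexGain w S x :=
  sub_nonneg.2 (maxWeight_mono w hS Set.sdiff_subset)

/-- Matching x to y earns the edge but gives up the gain of y in what remains. Together with
`vertexGain_eq_zero_or` this is the recursion for the gains, valid in any graph. -/
theorem sub_le_vertexGain (w : G.edgeSet → ℝ) {S : Set V} (hS : S.Finite) {x y : V} (hx : x ∈ S)
    (hy : y ∈ S) (h : G.Adj x y) :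
    w ⟨s(x, y), h⟩ - vertexGain w (S \ {x}) y ≤ vertexGain w S x := by
  have := add_maxWeight_le w hS hx hy h
  unfold vertexGain
  linarith

theorem vertexGain_eq_zero_or (w : G.edgeSet → ℝ) {S : Set V} (hS : S.Finite) (x : V) :
    vertexGain w S x = 0 ∨ ∃ y ∈ S, ∃ h : G.Adj x y,
      vertexGain w S x ≤ w ⟨s(x, y), h⟩ - vertexGain w (S \ {x}) y := by
  obtain ⟨M, hM, hw⟩ := exists_weight_eq_maxWeight w hS
  by_cases hx : ∃ f ∈ M, x ∈ (f : Sym2 V)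
  · obtain ⟨⟨f, hf⟩, hfM, hxf⟩ := hx
    obtain ⟨y, rfl⟩ := Sym2.mem_iff_exists.1 hxf
    refine Or.inr ⟨y, hM.1 _ hfM y (by simp), hf, ?_⟩
    have := weight_le_add_maxWeight w hS hf hM hfM
    unfold vertexGain
    linarith
  · left
    push Not at hx
    refine le_antisymm ?_ (vertexGain_nonneg w hS x)
    have : IsMatchingIn (S \ {x}) M :=
      ⟨fun f hf z hz => ⟨hM.1 f hf z hz, fun h => hx f hf (h ▸ hz)⟩, hM.2⟩
    have := weight_le_maxWeight w (hS.sdiff (t := {x})) this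
    unfold vertexGain
    linarith

/-! ### Truncated recursion on the tree and the decision about the root edge. -/

/-- The neighbours of `x` other than its parent. -/
noncomputable def children [G.LocallyFinite] (par : V → V) (x : V) : Finset V :=
  open Classical in (G.neighborFinset x).erase (par x)

theorem mem_children [G.LocallyFinite] {par : V → V} {x y : V} :
    y ∈ children (G := G) par x ↔ y ≠ par x ∧ G.Adj x y := by
  simp [children]

/-- Lower (`false`) and upper (`true`) bounds for the gain of a vertex, computed from the first
`n + 1` generations of its descendants. -/
noncomputable def gainBound [G.LocallyFinite] (par : V → V) (w : G.edgeSet → ℝ) :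
    Bool → ℕ → V → ℝ≥0
  | false, 0, _ => 0
  | true, 0, x => (children (G := G) par x).sup fun y => pairWeight w x y - 0
  | b, n + 1, x => (children (G := G) par x).sup fun y =>
      pairWeight w x y - gainBound par w (!b) n y

theorem gainBound_succ [G.LocallyFinite] (par : V → V) (w : G.edgeSet → ℝ) (b : Bool) (n : ℕ)
    (x : V) : gainBound par w b (n + 1) x = (children (G := G) par x).sup fun y =>
      pairWeight w x y - gainBound par w (!b) n y := by
  rw [gainBound]

theorem gainBound_false_le_true [G.LocallyFinite] (par : V → V) (w : G.edgeSet → ℝ) (n : ℕ) :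
    ∀ x : V, gainBound par w false n x ≤ gainBound par w true n x := by
  induction n with
  | zero => intro x; simp [gainBound]
  | succ n ih =>
    intro x
    rw [gainBound_succ, gainBound_succ]
    exact Finset.sup_mono_fun fun y _ => tsub_le_tsub_left (ih y) _

/-- Truncating weights and differences at 0 costs nothing because gains are nonnegative; the
sandwich therefore holds for arbitrary real weights, with no almost sure restriction. -/
theorem pairWeight_sub_le (w : G.edgeSet → ℝ) {x y : V} (h : G.Adj x y) {a : ℝ≥0} {b c : ℝ}
    (hba : b ≤ a) (hc : 0 ≤ c) (hle : w ⟨s(x, y), h⟩ - b ≤ c) :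
    ((pairWeight w x y - a : ℝ≥0) : ℝ) ≤ c := by
  rw [← Real.coe_toNNReal c hc, NNReal.coe_le_coe, tsub_le_iff_right, pairWeight, dif_pos h,
    Real.toNNReal_le_iff_le_coe]
  push_cast
  rw [Real.coe_toNNReal c hc]
  linarith

theorem le_pairWeight_sub (w : G.edgeSet → ℝ) {x y : V} (h : G.Adj x y) {a : ℝ≥0} {b c : ℝ}
    (hba : a ≤ b) (hle : c ≤ w ⟨s(x, y), h⟩ - b) :
    c ≤ ((pairWeight w x y - a : ℝ≥0) : ℝ) := by
  have h1 : (pairWeight w x y : ℝ) ≤ ((pairWeight w x y - a : ℝ≥0) : ℝ) + a := by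
    exact_mod_cast le_tsub_add
  have h2 : w ⟨s(x, y), h⟩ ≤ pairWeight w x y := by
    rw [pairWeight, dif_pos h]; exact Real.le_coe_toNNReal _
  linarith

/-- In an exploration of the graph in which every vertex `x` of depth less than `r` has all its
non-parent neighbours one level deeper, the gains are sandwiched by the bounds. -/
theorem gainBound_le_vertexGain_le [G.LocallyFinite] {par : V → V} {dep : V → ℕ} {r : ℕ} {u : V}
    (hu : dep u = 0)
    (hdep : ∀ x y, dep x < r → G.Adj x y → y ≠ par x → dep y = dep x + 1)
    (hpar : ∀ x y, dep x < r → G.Adj x y → y ≠ par x → par y = x)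
    (w : G.edgeSet → ℝ) (n : ℕ) : ∀ (x : V) (S : Set V), S.Finite → x ∈ S → dep x + n < r →
      par x ∉ S → (∀ z, z ≠ u → dep x ≤ dep z → dep z < r → z ∈ S) →
      (gainBound par w false n x : ℝ) ≤ vertexGain w S x ∧
        vertexGain w S x ≤ gainBound par w true n x := by
  induction n with
  | zero =>
    intro x S hS hx hn hp hz
    refine ⟨by simpa [gainBound] using vertexGain_nonneg w hS x, ?_⟩
    rcases vertexGain_eq_zero_or w hS x with h0 | ⟨y, hy, h, hle⟩
    · rw [h0]; positivity
    · refine (le_pairWeight_sub w h (a := 0)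
        (by simpa using vertexGain_nonneg w (hS.sdiff (t := {x})) y) hle).trans ?_
      have hyc : y ∈ children (G := G) par x := mem_children.2 ⟨fun h => hp (h ▸ hy), h⟩
      rw [gainBound]
      exact_mod_cast Finset.le_sup (f := fun y => pairWeight w x y - 0) hyc
  | succ n ih =>
    intro x S hS hx hn hp hz
    have key : ∀ y ∈ children (G := G) par x, y ∈ S ∧
        (gainBound par w false n y : ℝ) ≤ vertexGain w (S \ {x}) y ∧
        vertexGain w (S \ {x}) y ≤ gainBound par w true n y := by
      intro y hy
      obtain ⟨hyp, hxy⟩ := mem_children.1 hy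
      have hd := hdep x y (by omega) hxy hyp
      -- The lower bound needs the child to be present in `S`; the budget `dep x + (n + 1) < r`
      -- keeps its depth below `r`, out of reach of boundary deletions.
      have hyS : y ∈ S := hz y (by rintro rfl; omega) (by omega) (by omega)
      refine ⟨hyS, ih y (S \ {x}) hS.sdiff ⟨hyS, hxy.ne'⟩ (by omega) ?_ ?_⟩
      · rw [hpar x y (by omega) hxy hyp]; simp
      · intro z hzu hz1 hz2
        exact ⟨hz z hzu (by omega) hz2, by rintro rfl; omega⟩
    constructor
    · rw [gainBound_succ]
      obtain hC | hC := (children (G := G) par x).eq_empty_or_nonempty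
      · rw [hC]; simpa using vertexGain_nonneg w hS x
      · obtain ⟨y, hy, heq⟩ := Finset.exists_mem_eq_sup _ hC
          fun y => pairWeight w x y - gainBound par w (!false) n y
        rw [heq]
        obtain ⟨hyS, -, h2⟩ := key y hy
        exact pairWeight_sub_le w (mem_children.1 hy).2 h2 (vertexGain_nonneg w hS x)
          (sub_le_vertexGain w hS hx hyS _)
    · rw [gainBound_succ]
      rcases vertexGain_eq_zero_or w hS x with h0 | ⟨y, hy, h, hle⟩
      · rw [h0]; positivity
      · have hyc : y ∈ children (G := G) par x := mem_children.2 ⟨fun h => hp (h ▸ hy), h⟩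
        obtain ⟨-, h1, -⟩ := key y hyc
        refine (le_pairWeight_sub w h h1 hle).trans ?_
        exact_mod_cast Finset.le_sup
          (f := fun y => pairWeight w x y - gainBound par w (!true) n y) hyc

/-- The edge `uv` belongs to every maximum weight matching if its weight is at least the sum of
the upper bounds for the gains of its endpoints, and to no maximum weight matching if its weight is
less than the sum of the lower bounds. -/
theorem edge_mem_of_gainBound [G.LocallyFinite] {par : V → V} {dep : V → ℕ} {r : ℕ} {u v : V}
    (hu : dep u = 0) (hv : dep v = 0) (huv : G.Adj u v) (hpu : par u = v) (hpv : par v = u)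
    (hdep : ∀ x y, dep x < r → G.Adj x y → y ≠ par x → dep y = dep x + 1)
    (hpar : ∀ x y, dep x < r → G.Adj x y → y ≠ par x → par y = x)
    (w : G.edgeSet → ℝ) (n : ℕ) (hn : n + 1 < r) {S : Set V} (hS : S.Finite)
    (hz : ∀ z, dep z < r → z ∈ S) {M : Finset G.edgeSet}
    (hM : IsMatchingIn S M) (hMw : weight w M = maxWeight w S)
    (hMu : ∀ M' : Finset G.edgeSet, IsMatchingIn S M' → weight w M' = maxWeight w S → M' = M) :
    ((gainBound par w true (n + 1) u + gainBound par w true (n + 1) v : ℝ) ≤ w ⟨s(u, v), huv⟩ →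
        (⟨s(u, v), huv⟩ : G.edgeSet) ∈ M) ∧
      (w ⟨s(u, v), huv⟩ < (gainBound par w false (n + 1) u + gainBound par w false (n + 1) v : ℝ) →
        (⟨s(u, v), huv⟩ : G.edgeSet) ∉ M) := by
  classical
  have huS : u ∈ S := hz u (by omega)
  have hvS : v ∈ S := hz v (by omega)
  have hv' := gainBound_le_vertexGain_le hu hdep hpar w (n + 1) v (S \ {u}) hS.sdiff
    ⟨hvS, huv.ne'⟩ (by omega) (by simp [hpv]) (fun z hzu _ hzr => ⟨hz z hzr, hzu⟩)
  -- The root `u` is unrolled by hand: its parent `v` still lies in `S`, so the sandwich applies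
  -- only to its children, inside `S \ {u}`.
  have hchild : ∀ y ∈ children (G := G) par u, y ∈ S ∧
        (gainBound par w false n y : ℝ) ≤ vertexGain w (S \ {u}) y ∧
        vertexGain w (S \ {u}) y ≤ gainBound par w true n y := by
    intro y hy
    obtain ⟨hyp, hxy⟩ := mem_children.1 hy
    have hd := hdep u y (by omega) hxy hyp
    have hyS : y ∈ S := hz y (by omega)
    refine ⟨hyS, gainBound_le_vertexGain_le hu hdep hpar w n y (S \ {u}) hS.sdiff
      ⟨hyS, hxy.ne'⟩ (by omega) ?_ (fun z hzu _ hzr => ⟨hz z hzr, hzu⟩)⟩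
    rw [hpar u y (by omega) hxy hyp]; simp
  constructor
  · intro hle
    have hgain : vertexGain w S u ≤ w ⟨s(u, v), huv⟩ - vertexGain w (S \ {u}) v := by
      rcases vertexGain_eq_zero_or w hS u with h0 | ⟨y, hy, h, hy'⟩
      · rw [h0]
        have : (0 : ℝ) ≤ gainBound par w true (n + 1) u := NNReal.coe_nonneg _
        linarith [hv'.2]
      -- If the best partner of `u` is not `v`, the gain of `u` is at most its upper bound, which
      -- the assumption makes at most the weight of `uv` minus the gain of `v`.
      · by_cases hyv : y = v
        · subst hyv; exact hy'
        · have hyc : y ∈ children (G := G) par u := mem_children.2 ⟨by rwa [hpu], h⟩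
          have h1 := le_pairWeight_sub w h (hchild y hyc).2.1 hy'
          have h2 : pairWeight w u y - gainBound par w (!true) n y
              ≤ gainBound par w true (n + 1) u := by
            rw [gainBound_succ]
            exact Finset.le_sup (f := fun y => pairWeight w u y - gainBound par w (!true) n y) hyc
          have h3 : vertexGain w S u ≤ gainBound par w true (n + 1) u :=
            h1.trans (by exact_mod_cast h2)
          linarith [hv'.2]
    obtain ⟨N, hN, hNw⟩ := exists_weight_eq_maxWeight w ((hS.sdiff (t := {u})).sdiff (t := {v}))
    obtain ⟨hn', hI⟩ := hN.insert_edge huS hvS huv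
    have hw : weight w (insert ⟨s(u, v), huv⟩ N) = maxWeight w S := by
      refine le_antisymm (weight_le_maxWeight w hS hI) ?_
      rw [weight, Finset.sum_insert hn']
      unfold vertexGain at hgain
      unfold weight at hNw
      linarith
    rw [← hMu _ hI hw]
    exact Finset.mem_insert_self _ _
  · intro hlt he
    have h1 := weight_le_add_maxWeight w hS huv hM he
    have hgain : vertexGain w S u ≤ w ⟨s(u, v), huv⟩ - vertexGain w (S \ {u}) v := by
      unfold vertexGain; linarith
    have h2 : (gainBound par w false (n + 1) u : ℝ) ≤ vertexGain w S u := by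
      rw [gainBound_succ]
      obtain hC | hC := (children (G := G) par u).eq_empty_or_nonempty
      · rw [hC]; simpa using vertexGain_nonneg w hS u
      · obtain ⟨y, hy, heq⟩ := Finset.exists_mem_eq_sup _ hC
          fun y => pairWeight w u y - gainBound par w (!false) n y
        rw [heq]
        obtain ⟨hyS, -, h2⟩ := hchild y hy
        exact pairWeight_sub_le w (mem_children.1 hy).2 h2 (vertexGain_nonneg w hS u)
          (sub_le_vertexGain w hS huS hyS _)
    linarith [hv'.1]

/-! ### The deterministic recursion for Laplace transforms and its contraction. -/

section LaplaceStep


/-- The Laplace-transform recursion `a ↦ ∫₀¹ ∏ (1 - s aᵢ) ds`. -/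
noncomputable def laplaceStep {ι : Type*} (C : Finset ι) (a : ι → ℝ) : ℝ :=
  ∫ s in (0 : ℝ)..1, ∏ i ∈ C, (1 - s * a i)

variable {ι : Type*} {C : Finset ι} {a b : ι → ℝ}

theorem prod_one_sub_mul_mono {s : ℝ} (hs : s ∈ Set.Icc (0 : ℝ) 1) (hab : ∀ i ∈ C, a i ≤ b i)
    (hb : ∀ i ∈ C, b i ≤ 1) : ∏ i ∈ C, (1 - s * b i) ≤ ∏ i ∈ C, (1 - s * a i) := by
  refine Finset.prod_le_prod (fun i hi => ?_) fun i hi => ?_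
  · nlinarith [hb i hi, hs.1, hs.2]
  · nlinarith [hab i hi, hs.1]

theorem prod_one_sub_mul_nonneg {s : ℝ} (hs : s ∈ Set.Icc (0 : ℝ) 1) (ha : ∀ i ∈ C, a i ≤ 1) :
    0 ≤ ∏ i ∈ C, (1 - s * a i) :=
  Finset.prod_nonneg fun i hi => by nlinarith [ha i hi, hs.1, hs.2]

theorem prod_one_sub_mul_le_one {s : ℝ} (hs : s ∈ Set.Icc (0 : ℝ) 1) (ha0 : ∀ i ∈ C, 0 ≤ a i)
    (ha : ∀ i ∈ C, a i ≤ 1) : ∏ i ∈ C, (1 - s * a i) ≤ 1 :=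
  Finset.prod_le_one (fun i hi => by nlinarith [ha i hi, hs.1, hs.2])
    fun i hi => by nlinarith [ha0 i hi, hs.1]

theorem laplaceStep_anti (hab : ∀ i ∈ C, a i ≤ b i) (hb : ∀ i ∈ C, b i ≤ 1) :
    laplaceStep C b ≤ laplaceStep C a := by
  refine intervalIntegral.integral_mono_on zero_le_one
    (Continuous.intervalIntegrable (by fun_prop) _ _)
    (Continuous.intervalIntegrable (by fun_prop) _ _) fun s hs => ?_
  exact prod_one_sub_mul_mono hs hab hb

theorem laplaceStep_le_one (ha0 : ∀ i ∈ C, 0 ≤ a i) (ha : ∀ i ∈ C, a i ≤ 1) :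
    laplaceStep C a ≤ 1 := by
  have := laplaceStep_anti (a := fun _ => 0) ha0 ha
  simpa [laplaceStep] using this

theorem integral_one_sub_pow (n : ℕ) : ∫ s in (0 : ℝ)..1, (1 - s) ^ n = 1 / (n + 1) := by
  have := intervalIntegral.integral_comp_sub_left (a := 0) (b := 1) (fun s : ℝ => s ^ n) 1
  rw [this]
  simp [integral_pow]

theorem integral_mul_one_sub_pow (n : ℕ) :
    ∫ s in (0 : ℝ)..1, s * (1 - s) ^ n = 1 / ((n + 1) * (n + 2)) := by
  have : ∀ s : ℝ, s * (1 - s) ^ n = (1 - s) ^ n - (1 - s) ^ (n + 1) := fun s => by ring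
  simp only [this]
  rw [intervalIntegral.integral_sub (Continuous.intervalIntegrable (by fun_prop) _ _)
    (Continuous.intervalIntegrable (by fun_prop) _ _), integral_one_sub_pow, integral_one_sub_pow]
  push_cast
  field_simp
  ring

/-- The worst case is every `a i = 1`, where the integral is that of a power of `1 - s`. -/
theorem one_div_le_laplaceStep {n : ℕ} (hC : C.card ≤ n) (ha : ∀ i ∈ C, a i ≤ 1) :
    1 / ((n : ℝ) + 1) ≤ laplaceStep C a := by
  have := laplaceStep_anti ha (fun _ _ => le_refl (1 : ℝ))
  refine le_trans ?_ this
  simp only [laplaceStep, mul_one, Finset.prod_const, integral_one_sub_pow]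
  gcongr

theorem laplaceStep_le_of_mem {i : ι} (hi : i ∈ C) (ha0 : ∀ i ∈ C, 0 ≤ a i)
    (ha : ∀ i ∈ C, a i ≤ 1) : laplaceStep C a ≤ 1 - a i / 2 := by
  classical
  have h1 : laplaceStep C a ≤ ∫ s in (0 : ℝ)..1, (1 - s * a i) := by
    refine intervalIntegral.integral_mono_on zero_le_one
      (Continuous.intervalIntegrable (by fun_prop) _ _)
      (Continuous.intervalIntegrable (by fun_prop) _ _) fun s hs => ?_
    rw [← Finset.mul_prod_erase _ _ hi]
    refine mul_le_of_le_one_right (by nlinarith [ha i hi, hs.1, hs.2]) ?_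
    exact prod_one_sub_mul_le_one hs (fun j hj => ha0 j (Finset.mem_of_mem_erase hj))
      fun j hj => ha j (Finset.mem_of_mem_erase hj)
  refine h1.trans (le_of_eq ?_)
  rw [intervalIntegral.integral_sub (Continuous.intervalIntegrable (by fun_prop) _ _)
    (Continuous.intervalIntegrable (by fun_prop) _ _)]
  simp
  ring

/-- Contraction of the recursion under scaling. -/
theorem laplaceStep_contraction {c t : ℝ} (ht0 : 0 ≤ t) (ht1 : t ≤ 1) (ha0 : ∀ i ∈ C, 0 ≤ a i)
    (ha : ∀ i ∈ C, a i ≤ 1) (hc0 : 0 ≤ c) (hc : c ≤ ∏ i ∈ C, (1 - a i)) :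
    (t + (1 - t) * c) * laplaceStep C (fun i => t * a i) ≤ laplaceStep C a := by
  have hcont : Continuous fun s : ℝ => ∏ i ∈ C, (1 - s * a i) := by fun_prop
  -- Rescaling s turns the scaled recursion into the part of the integral over [0, t].
  have h1 : t * laplaceStep C (fun i => t * a i) = ∫ s in (0 : ℝ)..t, ∏ i ∈ C, (1 - s * a i) := by
    have := intervalIntegral.mul_integral_comp_mul_left (a := 0) (b := 1)
      (f := fun s : ℝ => ∏ i ∈ C, (1 - s * a i)) t
    rw [mul_zero, mul_one] at this
    have h (s : ℝ) : ∏ i ∈ C, (1 - s * (t * a i)) = ∏ i ∈ C, (1 - t * s * a i) :=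
      Finset.prod_congr rfl fun i _ => by ring
    simp only [← this, laplaceStep, h]
  have h2 : (1 - t) * c ≤ ∫ s in t..1, ∏ i ∈ C, (1 - s * a i) := by
    have : ∫ s in t..1, c ≤ ∫ s in t..1, ∏ i ∈ C, (1 - s * a i) := by
      refine intervalIntegral.integral_mono_on ht1 (Continuous.intervalIntegrable (by fun_prop) _ _)
        (hcont.intervalIntegrable _ _) fun s hs => hc.trans ?_
      refine Finset.prod_le_prod (fun i hi => by linarith [ha i hi]) fun i hi => ?_
      nlinarith [ha0 i hi, hs.2]
    simpa using this
  have h3 : laplaceStep C (fun i => t * a i) ≤ 1 :=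
    laplaceStep_le_one (fun i hi => mul_nonneg ht0 (ha0 i hi))
      fun i hi => mul_le_one₀ ht1 (ha0 i hi) (ha i hi)
  have h4 : laplaceStep C a = (∫ s in (0 : ℝ)..t, ∏ i ∈ C, (1 - s * a i))
      + ∫ s in t..1, ∏ i ∈ C, (1 - s * a i) :=
    (intervalIntegral.integral_add_adjacent_intervals (hcont.intervalIntegrable _ _)
      (hcont.intervalIntegrable _ _)).symm
  have h5 : (1 - t) * c * laplaceStep C (fun i => t * a i) ≤ (1 - t) * c :=
    mul_le_of_le_one_right (mul_nonneg (by linarith) hc0) h3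
  rw [h4, ← h1, add_mul]
  linarith

/-- Contraction of the recursion under scaling of all coordinates but one, which equals `1`. -/
theorem laplaceStep_contraction_of_mem [DecidableEq ι] {t : ℝ} {j : ι} {n : ℕ} (hj : j ∈ C)
    (hC : C.card ≤ n + 1)
    (ht0 : 0 ≤ t) (ht1 : t ≤ 1) (ha0 : ∀ i ∈ C, 0 ≤ a i) (ha : ∀ i ∈ C, a i ≤ 1) (haj : a j = 1) :
    (t + (1 - t) * (t / ((n + 1) * (n + 2)))) * laplaceStep C (Function.update (t • a) j 1)
      ≤ laplaceStep C a := by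
  set C' := C.erase j with hC'
  have hsub : ∀ {i}, i ∈ C' → i ∈ C := fun h => Finset.mem_of_mem_erase h
  have hta0 : ∀ i ∈ C', 0 ≤ t * a i := fun i hi => mul_nonneg ht0 (ha0 i (hsub hi))
  have hta1 : ∀ i ∈ C', t * a i ≤ 1 := fun i hi => mul_le_one₀ ht1 (ha0 i (hsub hi)) (ha i (hsub hi))
  have e1 : laplaceStep C a = ∫ s in (0 : ℝ)..1, (1 - s) * ∏ i ∈ C', (1 - s * a i) := by
    unfold laplaceStep
    congr 1; ext s
    rw [← Finset.mul_prod_erase _ _ hj, haj, mul_one]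
  have e2 : laplaceStep C (Function.update (t • a) j 1)
      = ∫ s in (0 : ℝ)..1, (1 - s) * ∏ i ∈ C', (1 - s * (t * a i)) := by
    unfold laplaceStep
    congr 1; ext s
    rw [← Finset.mul_prod_erase _ _ hj, Function.update_self, mul_one]
    congr 1
    refine Finset.prod_congr rfl fun i hi => ?_
    rw [Function.update_of_ne (Finset.ne_of_mem_erase hi)]
    simp
  have hJ1 : laplaceStep C (Function.update (t • a) j 1) ≤ 1 := by
    rw [e2]
    have : ∫ s in (0 : ℝ)..1, (1 - s) * ∏ i ∈ C', (1 - s * (t * a i)) ≤ ∫ s in (0 : ℝ)..1, 1 := by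
      refine intervalIntegral.integral_mono_on zero_le_one
        (Continuous.intervalIntegrable (by fun_prop) _ _)
        (Continuous.intervalIntegrable (by fun_prop) _ _) fun s hs => ?_
      have h0 := prod_one_sub_mul_nonneg hs hta1
      have h1 := prod_one_sub_mul_le_one hs hta0 hta1
      nlinarith [hs.1, hs.2]
    simpa using this
  have h1 : ∫ s in (0 : ℝ)..t, (1 - s) * ∏ i ∈ C', (1 - s * a i) ≤ laplaceStep C a := by
    rw [e1, ← intervalIntegral.integral_add_adjacent_intervals (a := 0) (b := t) (c := 1)
      (Continuous.intervalIntegrable (by fun_prop) _ _)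
      (Continuous.intervalIntegrable (by fun_prop) _ _)]
    refine le_add_of_nonneg_right (intervalIntegral.integral_nonneg ht1 fun s hs => ?_)
    have hs' : s ∈ Set.Icc (0 : ℝ) 1 := ⟨ht0.trans hs.1, hs.2⟩
    exact mul_nonneg (by linarith [hs.2]) (prod_one_sub_mul_nonneg hs' fun i hi => ha i (hsub hi))
  -- After rescaling, the factor of `j` becomes 1 - ts = (1 - s) + (1 - t) s. The second summand is
  -- the surplus; it replaces the contribution of [t, 1], whose lower bound by ∏ (1 - a i) is
  -- useless here since `a j = 1`.
  have h2 : ∫ s in (0 : ℝ)..t, (1 - s) * ∏ i ∈ C', (1 - s * a i)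
      = t * ((∫ s in (0 : ℝ)..1, (1 - s) * ∏ i ∈ C', (1 - s * (t * a i)))
        + (1 - t) * ∫ s in (0 : ℝ)..1, s * ∏ i ∈ C', (1 - s * (t * a i))) := by
    have := intervalIntegral.mul_integral_comp_mul_left (a := 0) (b := 1)
      (f := fun s : ℝ => (1 - s) * ∏ i ∈ C', (1 - s * a i)) t
    rw [mul_zero, mul_one] at this
    rw [← this, ← intervalIntegral.integral_const_mul (1 - t), ← intervalIntegral.integral_add
      (Continuous.intervalIntegrable (by fun_prop) _ _)
      (Continuous.intervalIntegrable (by fun_prop) _ _)]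
    congr 2; ext s
    have : ∏ i ∈ C', (1 - t * s * a i) = ∏ i ∈ C', (1 - s * (t * a i)) :=
      Finset.prod_congr rfl fun i _ => by ring
    rw [this]; ring
  have h3 : 1 / (((n : ℝ) + 1) * (n + 2))
      ≤ ∫ s in (0 : ℝ)..1, s * ∏ i ∈ C', (1 - s * (t * a i)) := by
    rw [← integral_mul_one_sub_pow]
    refine intervalIntegral.integral_mono_on zero_le_one
      (Continuous.intervalIntegrable (by fun_prop) _ _)
      (Continuous.intervalIntegrable (by fun_prop) _ _) fun s hs => ?_
    refine mul_le_mul_of_nonneg_left ?_ hs.1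
    have hcard : C'.card ≤ n := by rw [hC', Finset.card_erase_of_mem hj]; omega
    calc (1 - s) ^ n ≤ (1 - s) ^ C'.card :=
          pow_le_pow_of_le_one (by linarith [hs.2]) (by linarith [hs.1]) hcard
      _ = ∏ i ∈ C', (1 - s * 1) := by simp
      _ ≤ _ := prod_one_sub_mul_mono hs hta1 fun _ _ => le_rfl
  have hk : 0 ≤ t / (((n : ℝ) + 1) * (n + 2)) := by positivity
  have h5 : (1 - t) * (t / (((n : ℝ) + 1) * (n + 2)))
      * laplaceStep C (Function.update (t • a) j 1) ≤ (1 - t) * (t / (((n : ℝ) + 1) * (n + 2))) :=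
    mul_le_of_le_one_right (mul_nonneg (by linarith) hk) hJ1
  have h6 : (1 - t) * (t / (((n : ℝ) + 1) * (n + 2)))
      ≤ t * ((1 - t) * ∫ s in (0 : ℝ)..1, s * ∏ i ∈ C', (1 - s * (t * a i))) := by
    calc (1 - t) * (t / (((n : ℝ) + 1) * (n + 2)))
        = t * ((1 - t) * (1 / (((n : ℝ) + 1) * (n + 2)))) := by ring
      _ ≤ _ := by gcongr
  rw [h2, ← e2, mul_add] at h1
  rw [add_mul]
  linarith

/-- Origin of the constant (2D)^(-D): at most `D` factors, each at least 1/(2D). -/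
theorem two_mul_pow_inv_le_prod {D : ℕ} (hD : 1 ≤ D) (hC : C.card ≤ D)
    (ha : ∀ i ∈ C, a i ≤ 1 - 1 / (2 * D)) : ((2 * (D : ℝ)) ^ D)⁻¹ ≤ ∏ i ∈ C, (1 - a i) := by
  have hD' : (1 : ℝ) ≤ D := by exact_mod_cast hD
  calc ((2 * (D : ℝ)) ^ D)⁻¹ ≤ ((2 * (D : ℝ)) ^ C.card)⁻¹ := by
        gcongr
        linarith
    _ = ∏ i ∈ C, (1 / (2 * (D : ℝ))) := by rw [Finset.prod_const, one_div, inv_pow]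
    _ ≤ _ := Finset.prod_le_prod (fun _ _ => by positivity) fun i hi => by linarith [ha i hi]

/-- The same constant also serves the leaf case: with D = n + 2 and t ≥ 1/D, the surplus rate
t/((n+1)(n+2)) is at least (2D)^(-D). -/
theorem two_mul_pow_inv_le {n : ℕ} :
    ((2 * ((n : ℝ) + 2)) ^ (n + 2))⁻¹ ≤ 1 / (n + 2) / ((n + 1) * (n + 2)) := by
  rw [div_div, one_div]
  gcongr
  have h2 : (1 : ℝ) ≤ 2 * (n + 2) := by nlinarith [Nat.cast_nonneg (α := ℝ) n]
  rcases n with _ | n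
  · norm_num
  -- The denominator on the other side is cubic, so three factors of the power suffice; the case of
  -- exponent 2 was checked separately.
  · have : (2 * (((n + 1 : ℕ) : ℝ) + 2)) ^ 3 ≤ (2 * (((n + 1 : ℕ) : ℝ) + 2)) ^ (n + 1 + 2) :=
      pow_le_pow_right₀ h2 (by omega)
    refine le_trans ?_ this
    push_cast
    have : (0 : ℝ) ≤ n := Nat.cast_nonneg n
    ring_nf
    nlinarith [mul_nonneg this this, mul_nonneg this (mul_nonneg this this)]

end LaplaceStep


/-! ### Exponential variables, independence, and the transform of a maximum. -/

section Probability

variable {Ω ι : Type*} {mΩ : MeasurableSpace Ω} {P : Measure Ω}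

theorem measure_eq_of_indepFun_eq_zero [IsProbabilityMeasure P] {X Y : Ω → ℝ} (hX : Measurable X)
    (hY : Measurable Y) (hXY : IndepFun X Y P) [NullSingletonClass (P.map X)] : P {ω | X ω = Y ω} = 0 := by
  have hms : MeasurableSet {p : ℝ × ℝ | p.1 = p.2} := measurableSet_eq_fun measurable_fst measurable_snd
  have hmap := (indepFun_iff_map_prod_eq_prod_map_map hX.aemeasurable hY.aemeasurable).1 hXY
  have := Measure.isProbabilityMeasure_map (μ := P) hX.aemeasurable
  have := Measure.isProbabilityMeasure_map (μ := P) hY.aemeasurable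
  have : P {ω | X ω = Y ω} = (P.map fun ω => (X ω, Y ω)) {p : ℝ × ℝ | p.1 = p.2} := by
    rw [Measure.map_apply (hX.prodMk hY) hms]; rfl
  rw [this, hmap, Measure.prod_apply_symm hms]
  refine (lintegral_congr fun y => ?_).trans lintegral_zero
  have : (fun x : ℝ => (x, y)) ⁻¹' {p : ℝ × ℝ | p.1 = p.2} = {y} := by ext; simp
  rw [this, measure_singleton]

theorem expMeasure_one_Iic {y : ℝ} (hy : 0 ≤ y) :
    expMeasure 1 (Set.Iic y) = ENNReal.ofReal (1 - Real.exp (-y)) := by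
  have := isProbabilityMeasure_expMeasure (r := 1) one_pos
  have h := cdf_expMeasure_eq (r := 1) one_pos y
  rw [if_pos hy, one_mul] at h
  rw [← h, ofReal_cdf]

theorem integrable_exp_neg [IsProbabilityMeasure P] {Z : Ω → ℝ} (hZ : Measurable Z)
    (hZ0 : ∀ ω, 0 ≤ Z ω) : Integrable (fun ω => Real.exp (-Z ω)) P := by
  refine Integrable.of_bound (by fun_prop) 1 (ae_of_all _ fun ω => ?_)
  rw [Real.norm_eq_abs, Real.abs_exp, Real.exp_le_one_iff]
  linarith [hZ0 ω]

/-- The probability that an exponential random variable is at most an independent nonnegative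
random variable. -/
theorem measureReal_le_of_indepFun [IsProbabilityMeasure P] {X Z : Ω → ℝ} (hX : Measurable X)
    (hZ : Measurable Z) (hXZ : IndepFun X Z P) (hlaw : P.map X = expMeasure 1)
    (hZ0 : ∀ ω, 0 ≤ Z ω) : P.real {ω | X ω ≤ Z ω} = 1 - ∫ ω, Real.exp (-Z ω) ∂P := by
  have hms : MeasurableSet {p : ℝ × ℝ | p.1 ≤ p.2} := measurableSet_le measurable_fst measurable_snd
  have hmap := (indepFun_iff_map_prod_eq_prod_map_map hX.aemeasurable hZ.aemeasurable).1 hXZ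
  have h1 : P {ω | X ω ≤ Z ω} = (P.map fun ω => (X ω, Z ω)) {p : ℝ × ℝ | p.1 ≤ p.2} := by
    rw [Measure.map_apply (hX.prodMk hZ) hms]; rfl
  have := Measure.isProbabilityMeasure_map (μ := P) hX.aemeasurable
  have := Measure.isProbabilityMeasure_map (μ := P) hZ.aemeasurable
  have h2 : P {ω | X ω ≤ Z ω} = ∫⁻ ω, ENNReal.ofReal (1 - Real.exp (-Z ω)) ∂P := by
    rw [h1, hmap, Measure.prod_apply_symm hms,
      lintegral_map (measurable_measure_prodMk_right hms) hZ]
    refine lintegral_congr fun ω => ?_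
    rw [hlaw, ← expMeasure_one_Iic (hZ0 ω)]
    rfl
  have hint := integrable_exp_neg (P := P) hZ hZ0
  rw [Measure.real, h2, ← ofReal_integral_eq_lintegral_ofReal
    (f := fun ω => 1 - Real.exp (-Z ω)) ((integrable_const 1).sub hint),
    ENNReal.toReal_ofReal, integral_sub (integrable_const 1) hint]
  · simp
  · refine integral_nonneg fun ω => ?_
    simpa using hZ0 ω
  · refine ae_of_all _ fun ω => ?_
    simpa using hZ0 ω

/-- The σ-algebra generated by the random variables with index in `F`. -/
abbrev sigmaOf (w : ι → Ω → ℝ) (F : Set ι) : MeasurableSpace Ω :=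
  ⨆ f ∈ F, (inferInstance : MeasurableSpace ℝ).comap (w f)

theorem sigmaOf_le {w : ι → Ω → ℝ} (hw : ∀ f, Measurable (w f)) (F : Set ι) : sigmaOf w F ≤ mΩ :=
  iSup₂_le fun f _ => (hw f).comap_le

theorem measurable_sigmaOf (w : ι → Ω → ℝ) {F : Set ι} {f : ι} (hf : f ∈ F) :
    Measurable[sigmaOf w F] (w f) :=
  measurable_iff_comap_le.2 (le_iSup₂_of_le f hf le_rfl)

theorem sigmaOf_mono (w : ι → Ω → ℝ) {F F' : Set ι} (h : F ⊆ F') : sigmaOf w F ≤ sigmaOf w F' :=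
  biSup_mono fun _ hf => h hf

theorem indep_sigmaOf {w : ι → Ω → ℝ} (hw : ∀ f, Measurable (w f)) (hind : iIndepFun w P)
    {F F' : Set ι} (h : Disjoint F F') : Indep (sigmaOf w F) (sigmaOf w F') P :=
  indep_iSup_of_disjoint (fun f => (hw f).comap_le) hind h

theorem indepFun_of_sigmaOf {w : ι → Ω → ℝ} (hw : ∀ f, Measurable (w f)) (hind : iIndepFun w P)
    {F F' : Set ι} (h : Disjoint F F') {α β : Type*} [MeasurableSpace α] [MeasurableSpace β]
    {X : Ω → α} {Y : Ω → β} (hX : Measurable[sigmaOf w F] X) (hY : Measurable[sigmaOf w F'] Y) :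
    IndepFun X Y P :=
  indep_of_indep_of_le_left (indep_of_indep_of_le_right (indep_sigmaOf hw hind h) hY.comap_le)
    hX.comap_le

/-- Events determined by disjoint sets of variables are independent. -/
theorem measureReal_biInter_of_disjoint [IsProbabilityMeasure P] {κ : Type*} {w : ι → Ω → ℝ}
    (hw : ∀ f, Measurable (w f)) (hind : iIndepFun w P) (F : κ → Set ι) (A : κ → Set Ω)
    (C : Finset κ) (hdis : ∀ i ∈ C, ∀ j ∈ C, i ≠ j → Disjoint (F i) (F j))
    (hA : ∀ i ∈ C, MeasurableSet[sigmaOf w (F i)] (A i)) :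
    P.real (⋂ i ∈ C, A i) = ∏ i ∈ C, P.real (A i) := by
  classical
  induction C using Finset.induction_on with
  | empty => simp
  | insert j C hj ih =>
    rw [Finset.prod_insert hj, ← ih (fun a ha b hb => hdis a (by simp [ha]) b (by simp [hb]))
      (fun a ha => hA a (by simp [ha])), Finset.set_biInter_insert]
    have hd : Disjoint (F j) (⋃ i ∈ C, F i) := by
      simp only [Set.disjoint_iUnion_right]
      exact fun i hi => hdis j (by simp) i (by simp [hi]) (by rintro rfl; exact hj hi)
    have := (Indep_iff _ _ _).1 (indep_sigmaOf hw hind hd) _ _ (hA j (by simp))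
      (Finset.measurableSet_biInter C fun i hi =>
        sigmaOf_mono w (Set.subset_biUnion_of_mem (u := F) hi) _ (hA i (by simp [hi])))
    simp only [Measure.real, this, ENNReal.toReal_mul]

/-- The Laplace transform at `1` of a maximum of independent differences. -/
theorem integral_exp_neg_sup [IsProbabilityMeasure P] {κ : Type*} {w : ι → Ω → ℝ}
    (hw : ∀ f, Measurable (w f)) (hind : iIndepFun w P) (hlaw : ∀ f, P.map (w f) = expMeasure 1)
    (C : Finset κ) (F F' : κ → Set ι) (g : κ → ι) (Y : κ → Ω → ℝ≥0) (W : κ → Ω → ℝ≥0)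
    (hW : ∀ i ∈ C, ∀ ω, W i ω = (w (g i) ω).toNNReal)
    (hdis : ∀ i ∈ C, ∀ j ∈ C, i ≠ j → Disjoint (F i) (F j)) (hg : ∀ i ∈ C, g i ∈ F i)
    (hF' : ∀ i ∈ C, F' i ⊆ F i) (hgF' : ∀ i ∈ C, g i ∉ F' i)
    (hY : ∀ i ∈ C, Measurable[sigmaOf w (F' i)] (Y i)) :
    ∫ ω, Real.exp (-(C.sup fun i => W i ω - Y i ω : ℝ≥0)) ∂P
      = laplaceStep C fun i => ∫ ω, Real.exp (-(Y i ω : ℝ)) ∂P := by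
  classical
  have hYm : ∀ i ∈ C, Measurable (Y i) := fun i hi => (hY i hi).mono (sigmaOf_le hw _) le_rfl
  -- Layer-cake formula: exp(-max) takes values in (0, 1], and its superlevel sets are intersections
  -- of events living on disjoint sets of edges.
  have hset : ∀ s ∈ Set.Ioc (0 : ℝ) 1,
      {ω | s ≤ Real.exp (-((C.sup fun i => W i ω - Y i ω : ℝ≥0) : ℝ))}
        = ⋂ i ∈ C, {ω | w (g i) ω ≤ -Real.log s + Y i ω} := by
    intro s hs
    have hl : 0 ≤ -Real.log s := by linarith [Real.log_nonpos hs.1.le hs.2]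
    ext ω
    simp only [Set.mem_ofPred_eq, Set.mem_iInter]
    rw [← Real.log_le_iff_le_exp hs.1, le_neg, ← Real.coe_toNNReal _ hl, NNReal.coe_le_coe,
      Finset.sup_le_iff]
    refine forall₂_congr fun i hi => ?_
    rw [tsub_le_iff_right, hW i hi, Real.toNNReal_le_iff_le_coe]
    push_cast
    rfl
  have hsupm : Measurable fun ω => C.sup fun i => W i ω - Y i ω := by
    have : ∀ C' ⊆ C, Measurable fun ω => C'.sup fun i => W i ω - Y i ω := by
      intro C' hC'
      induction C' using Finset.induction_on with
      | empty => simp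
      | insert j C' hj ih =>
        simp only [Finset.sup_insert]
        have hjC : j ∈ C := hC' (Finset.mem_insert_self _ _)
        refine Measurable.sup ?_ (ih ((Finset.subset_insert _ _).trans hC'))
        have : W j = fun ω => (w (g j) ω).toNNReal := funext (hW j hjC)
        rw [this]
        exact (hw _).real_toNNReal.sub (hYm j hjC)
    exact this C subset_rfl
  rw [(integrable_exp_neg (P := P) (Z := fun ω => ((C.sup fun i => W i ω - Y i ω : ℝ≥0) : ℝ))
    (measurable_coe_nnreal_real.comp hsupm)
    fun ω => NNReal.coe_nonneg _).integral_eq_integral_Ioc_meas_le (M := 1)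
    (ae_of_all _ fun ω => (Real.exp_pos _).le)
    (ae_of_all _ fun ω => by simp), laplaceStep, intervalIntegral.integral_of_le zero_le_one]
  refine setIntegral_congr_fun measurableSet_Ioc fun s hs => ?_
  have hl : 0 ≤ -Real.log s := by linarith [Real.log_nonpos hs.1.le hs.2]
  rw [hset s hs, measureReal_biInter_of_disjoint hw hind F _ C hdis]
  · refine Finset.prod_congr rfl fun i hi => ?_
    have hind' : IndepFun (w (g i)) (fun ω => -Real.log s + (Y i ω : ℝ)) P := by
      have h0 : IndepFun (w (g i)) (Y i) P := indepFun_of_sigmaOf hw hind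
        (F := {g i}) (F' := F' i) (by simpa using hgF' i hi) (measurable_sigmaOf w rfl) (hY i hi)
      exact h0.comp (φ := id) (ψ := fun y : ℝ≥0 => -Real.log s + (y : ℝ)) measurable_id
        (by fun_prop)
    have hYi := hYm i hi
    rw [measureReal_le_of_indepFun (hw _) (by fun_prop) hind' (hlaw _)
      fun ω => add_nonneg hl (NNReal.coe_nonneg _)]
    -- The exponential tail gives P(w ≤ -log s + Y) = 1 - s E exp(-Y), which is the factor in
    -- `laplaceStep`.
    simp only [neg_add, neg_neg, Real.exp_add, Real.exp_log hs.1]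
    rw [integral_const_mul]
  · intro i hi
    refine @measurableSet_le _ _ _ _ _ (sigmaOf w (F i)) _ _ _ _ _
      (measurable_sigmaOf w (hg i hi)) ?_
    have h1 : Measurable[sigmaOf w (F i)] (Y i) := (hY i hi).mono (sigmaOf_mono w (hF' i hi)) le_rfl
    exact (show Measurable fun y : ℝ≥0 => -Real.log s + (y : ℝ) by fun_prop).comp h1

end Probability


/-! ### Rooted structure and the edges below a vertex. -/

/-- `dep` and `par` are the depth and parent functions of a graph which, up to depth `r`, is a tree
hanging from the two endpoints of the edge `uv`, each endpoint being the parent of the other. -/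
structure IsRootedAt (G : SimpleGraph V) (par : V → V) (dep : V → ℕ) (r : ℕ) (u v : V) : Prop where
  adj : G.Adj u v
  dep_left : dep u = 0
  dep_right : dep v = 0
  par_left : par u = v
  par_right : par v = u
  adj_par : ∀ x, dep x ≤ r → G.Adj x (par x)
  dep_child : ∀ x y, dep x < r → G.Adj x y → y ≠ par x → dep y = dep x + 1
  par_child : ∀ x y, dep x < r → G.Adj x y → y ≠ par x → par y = x

/-- The edges whose endpoint of larger depth is `y` or a descendant of `y`. -/
def edgesBelow (G : SimpleGraph V) (par : V → V) (dep : V → ℕ) (y : V) : Set G.edgeSet :=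
  {f | ∃ b ∈ (f : Sym2 V), (∀ a ∈ (f : Sym2 V), a ≠ b → dep a < dep b) ∧
    dep y ≤ dep b ∧ par^[dep b - dep y] b = y}

variable {par : V → V} {dep : V → ℕ} {r : ℕ} {u v : V}

/-- An edge determines its strictly deeper endpoint, which has a single ancestor at any given depth.
-/
theorem disjoint_edgesBelow {y y' : V} (h : y ≠ y') (hd : dep y = dep y') :
    Disjoint (edgesBelow G par dep y) (edgesBelow G par dep y') := by
  rw [Set.disjoint_left]
  rintro f ⟨b, hb, hlow, -, hp⟩ ⟨b', hb', hlow', -, hp'⟩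
  have : b = b' := by
    by_contra hne
    have h1 := hlow b' hb' (Ne.symm hne)
    have h2 := hlow' b hb hne
    omega
  subst this
  exact h (by rw [← hp, ← hp', hd])

namespace IsRootedAt

variable (hT : IsRootedAt G par dep r u v)
include hT

theorem root_notMem_edgesBelow (y : V) :
    (⟨s(u, v), hT.adj⟩ : G.edgeSet) ∉ edgesBelow G par dep y := by
  rintro ⟨b, hb, hlow, -⟩
  have h1 := hT.dep_left
  have h2 := hT.dep_right
  simp only [Sym2.mem_iff] at hb hlow
  rcases hb with rfl | rfl
  · have := hlow v (Or.inr rfl) hT.adj.ne'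
    omega
  · have := hlow u (Or.inl rfl) hT.adj.ne
    omega

variable [G.LocallyFinite]

theorem dep_of_mem_children {x y : V} (hx : dep x < r) (hy : y ∈ children (G := G) par x) :
    dep y = dep x + 1 :=
  hT.dep_child x y hx (mem_children.1 hy).2 (mem_children.1 hy).1

theorem edge_mem_edgesBelow {x y : V} (hx : dep x < r) (hy : y ∈ children (G := G) par x) :
    (⟨s(x, y), (mem_children.1 hy).2⟩ : G.edgeSet) ∈ edgesBelow G par dep y := by
  have hd := hT.dep_of_mem_children hx hy
  refine ⟨y, by simp, ?_, le_rfl, by simp⟩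
  intro a ha hay
  simp only [Sym2.mem_iff] at ha
  rcases ha with rfl | rfl
  · omega
  · exact absurd rfl hay

theorem edgesBelow_subset {y z : V} (hy : dep y < r) (hz : z ∈ children (G := G) par y) :
    edgesBelow G par dep z ⊆ edgesBelow G par dep y := by
  have hd := hT.dep_of_mem_children hy hz
  rintro f ⟨b, hb, hlow, hle, hp⟩
  refine ⟨b, hb, hlow, by omega, ?_⟩
  have : dep b - dep y = (dep b - dep z) + 1 := by omega
  rw [this, Function.iterate_succ_apply', hp]
  exact hT.par_child y z (by omega) (mem_children.1 hz).2 (mem_children.1 hz).1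

theorem edge_notMem_edgesBelow {x y z : V} (hx : dep x < r) (hy : y ∈ children (G := G) par x)
    (hyr : dep y < r) (hz : z ∈ children (G := G) par y) :
    (⟨s(x, y), (mem_children.1 hy).2⟩ : G.edgeSet) ∉ edgesBelow G par dep z := by
  have hd := hT.dep_of_mem_children hx hy
  have hd' := hT.dep_of_mem_children hyr hz
  rintro ⟨b, hb, -, hle, -⟩
  simp only [Sym2.mem_iff] at hb
  rcases hb with rfl | rfl <;> omega

theorem card_children_lt {D : ℕ} (hdeg : ∀ v : V, G.degree v ≤ D) {x : V} (hx : dep x ≤ r) :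
    (children (G := G) par x).card + 1 ≤ D := by
  classical
  have hmem : par x ∈ G.neighborFinset x := by simpa using hT.adj_par x hx
  have h1 : children (G := G) par x = (G.neighborFinset x).erase (par x) := by
    ext; simp [mem_children]
  rw [h1, Finset.card_erase_add_one hmem]
  exact hdeg x

end IsRootedAt

/-! ### Transforms of the gain bounds and the probability of the undecided window. -/

section Measurability

variable {Ω : Type*} [G.LocallyFinite]

/-- The σ-algebra is left free: with `sigmaOf` this says that the bound depends only on the edges
below, which yields independence; with the ambient one it is plain measurability. -/
theorem measurable_gainBound [mΩ : MeasurableSpace Ω] (hT : IsRootedAt G par dep r u v)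
    {w : G.edgeSet → Ω → ℝ} {F : Set G.edgeSet} (hw : ∀ f ∈ F, Measurable (w f)) (n : ℕ) :
    ∀ (b : Bool) (x : V), dep x + n < r →
      (∀ y ∈ children (G := G) par x, edgesBelow G par dep y ⊆ F) →
      Measurable fun ω => gainBound par (fun f => w f ω) b n x := by
  classical
  have hsup : ∀ (x : V) (g : V → Ω → ℝ≥0), dep x < r →
      (∀ y ∈ children (G := G) par x, edgesBelow G par dep y ⊆ F) →
      (∀ y ∈ children (G := G) par x, Measurable (g y)) →
      Measurable fun ω => (children (G := G) par x).sup
        fun y => pairWeight (fun f => w f ω) x y - g y ω := by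
    intro x g hx hF hg
    have : ∀ C' ⊆ children (G := G) par x, Measurable fun ω => C'.sup
        fun y => pairWeight (fun f => w f ω) x y - g y ω := by
      intro C' hC'
      induction C' using Finset.induction_on with
      | empty => simp
      | insert y C' hj ih =>
        simp only [Finset.sup_insert]
        have hy : y ∈ children (G := G) par x := hC' (Finset.mem_insert_self _ _)
        refine Measurable.sup ?_ (ih ((Finset.subset_insert _ _).trans hC'))
        simp only [pairWeight, dif_pos (mem_children.1 hy).2]
        exact (hw _ (hF y hy (hT.edge_mem_edgesBelow hx hy))).real_toNNReal.sub (hg y hy)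
    exact this _ subset_rfl
  induction n with
  | zero =>
    intro b x hx hF
    cases b
    · simp [gainBound]
    · simpa only [gainBound] using hsup x (fun _ _ => 0) hx hF (fun _ _ => measurable_const)
  | succ n ih =>
    intro b x hx hF
    simp only [gainBound_succ]
    refine hsup x _ (by omega) hF fun y hy => ih _ y ?_ fun z hz => ?_
    · rw [hT.dep_of_mem_children (by omega) hy]; omega
    · refine (hT.edgesBelow_subset ?_ hz).trans (hF y hy)
      rw [hT.dep_of_mem_children (by omega) hy]; omega

/-- The edges below the children of `x`. -/
def edgesBelowChildren (G : SimpleGraph V) [G.LocallyFinite] (par : V → V) (dep : V → ℕ) (x : V) :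
    Set G.edgeSet :=
  ⋃ y ∈ children (G := G) par x, edgesBelow G par dep y

theorem measurable_gainBound_sigmaOf (hT : IsRootedAt G par dep r u v)
    (w : G.edgeSet → Ω → ℝ) (b : Bool) {n : ℕ} {x : V} (hx : dep x + n < r) :
    Measurable[sigmaOf w (edgesBelowChildren G par dep x)]
      fun ω => gainBound par (fun f => w f ω) b n x :=
  measurable_gainBound (mΩ := sigmaOf w (edgesBelowChildren G par dep x)) hT
    (F := edgesBelowChildren G par dep x)
    (fun _ hf => measurable_sigmaOf w hf) n b x hx
    fun _ hy => Set.subset_biUnion_of_mem (u := fun y => edgesBelow G par dep y) hy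

variable [MeasurableSpace Ω]

/-- The Laplace transform at `1` of `gainBound`. -/
noncomputable def gainTransform (par : V → V) (w : G.edgeSet → Ω → ℝ) (P : Measure Ω) (b : Bool)
    (n : ℕ) (x : V) : ℝ :=
  ∫ ω, Real.exp (-(gainBound par (fun f => w f ω) b n x : ℝ)) ∂P

variable {P : Measure Ω} {w : G.edgeSet → Ω → ℝ}

theorem gainTransform_nonneg (b : Bool) (n : ℕ) (x : V) : 0 ≤ gainTransform par w P b n x :=
  integral_nonneg fun _ => (Real.exp_pos _).le

variable [IsProbabilityMeasure P]

theorem integral_exp_neg_sup_children (hT : IsRootedAt G par dep r u v)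
    (hw : ∀ f, Measurable (w f)) (hind : iIndepFun w P) (hlaw : ∀ f, P.map (w f) = expMeasure 1)
    {x : V} (hx : dep x < r) (F' : V → Set G.edgeSet) (Y : V → Ω → ℝ≥0)
    (hF' : ∀ y ∈ children (G := G) par x, F' y ⊆ edgesBelow G par dep y)
    (hgF' : ∀ (y) (hy : y ∈ children (G := G) par x),
      (⟨s(x, y), (mem_children.1 hy).2⟩ : G.edgeSet) ∉ F' y)
    (hY : ∀ y ∈ children (G := G) par x, Measurable[sigmaOf w (F' y)] (Y y)) :
    ∫ ω, Real.exp (-((children (G := G) par x).sup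
        fun y => pairWeight (fun f => w f ω) x y - Y y ω : ℝ≥0)) ∂P
      = laplaceStep (children (G := G) par x) fun y => ∫ ω, Real.exp (-(Y y ω : ℝ)) ∂P := by
  classical
  refine integral_exp_neg_sup hw hind hlaw (children (G := G) par x) (edgesBelow G par dep) F'
    (fun y => if h : G.Adj x y then ⟨s(x, y), h⟩ else ⟨s(u, v), hT.adj⟩) Y
    (fun y ω => pairWeight (fun f => w f ω) x y) ?_ ?_ ?_ hF' ?_ hY
  · intro y hy ω
    simp [pairWeight, dif_pos (mem_children.1 hy).2]
  · intro y hy z hz hyz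
    refine disjoint_edgesBelow hyz ?_
    rw [hT.dep_of_mem_children hx hy, hT.dep_of_mem_children hx hz]
  · intro y hy
    rw [dif_pos (mem_children.1 hy).2]
    exact hT.edge_mem_edgesBelow hx hy
  · intro y hy
    rw [dif_pos (mem_children.1 hy).2]
    exact hgF' y hy

theorem gainTransform_zero_true (hT : IsRootedAt G par dep r u v)
    (hw : ∀ f, Measurable (w f)) (hind : iIndepFun w P) (hlaw : ∀ f, P.map (w f) = expMeasure 1)
    {x : V} (hx : dep x < r) :
    gainTransform par w P true 0 x = laplaceStep (children (G := G) par x) fun _ => 1 := by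
  have := integral_exp_neg_sup_children hT hw hind hlaw hx (fun _ => ∅) (fun _ _ => 0) (by simp)
    (by simp) (fun _ _ => measurable_const)
  simpa [gainTransform, gainBound] using this

theorem gainTransform_succ (hT : IsRootedAt G par dep r u v)
    (hw : ∀ f, Measurable (w f)) (hind : iIndepFun w P) (hlaw : ∀ f, P.map (w f) = expMeasure 1)
    (b : Bool) {n : ℕ} {x : V} (hx : dep x + (n + 1) < r) :
    gainTransform par w P b (n + 1) x
      = laplaceStep (children (G := G) par x) (gainTransform par w P (!b) n) := by
  have hd : ∀ y ∈ children (G := G) par x, dep y + n < r := fun y hy => by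
    rw [hT.dep_of_mem_children (by omega) hy]; omega
  have := integral_exp_neg_sup_children hT hw hind hlaw (x := x) (by omega)
    (edgesBelowChildren G par dep) (fun y ω => gainBound par (fun f => w f ω) (!b) n y)
    (fun y hy => Set.iUnion₂_subset fun z hz => hT.edgesBelow_subset
      (by have := hd y hy; omega) hz)
    (fun y hy hmem => by
      obtain ⟨z, hz, hmem⟩ := Set.mem_iUnion₂.1 hmem
      exact hT.edge_notMem_edgesBelow (by omega) hy (by have := hd y hy; omega) hz hmem)
    (fun y hy => measurable_gainBound_sigmaOf hT w _ (hd y hy))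
  simp only [gainTransform, gainBound_succ]
  exact this

theorem measurable_gainBound_of_measurable (hT : IsRootedAt G par dep r u v)
    (hw : ∀ f, Measurable (w f)) (b : Bool) {n : ℕ} {x : V} (hx : dep x + n < r) :
    Measurable fun ω => gainBound par (fun f => w f ω) b n x :=
  measurable_gainBound hT (F := Set.univ) (fun f _ => hw f) n b x hx fun _ _ => Set.subset_univ _

theorem gainTransform_le_one (hT : IsRootedAt G par dep r u v)
    (hw : ∀ f, Measurable (w f)) (b : Bool) {n : ℕ} {x : V} (hx : dep x + n < r) :
    gainTransform par w P b n x ≤ 1 := by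
  have h := integral_mono (μ := P) (integrable_exp_neg (measurable_coe_nnreal_real.comp
    (measurable_gainBound_of_measurable hT hw b hx)) fun ω => NNReal.coe_nonneg _)
    (integrable_const (1 : ℝ)) (fun ω => by simp)
  simpa [gainTransform] using h

/-- At a leaf both bounds vanish at every level, so the two transforms agree exactly, but they are
not bounded away from 1. -/
theorem gainTransform_eq_one_of_children_eq_empty {x : V}
    (hx : children (G := G) par x = ∅) (b : Bool) (n : ℕ) : gainTransform par w P b n x = 1 := by
  have : ∀ w' : G.edgeSet → ℝ, gainBound par w' b n x = 0 := by
    intro w'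
    cases n <;> cases b <;> simp [gainBound, hx]
  simp [gainTransform, this]

/-- The parent uses up one neighbour, leaving at most D - 1 children. -/
theorem one_div_le_gainTransform (hT : IsRootedAt G par dep r u v)
    (hw : ∀ f, Measurable (w f)) (hind : iIndepFun w P) (hlaw : ∀ f, P.map (w f) = expMeasure 1)
    {D : ℕ} (hdeg : ∀ v : V, G.degree v ≤ D) (b : Bool) {n : ℕ} {x : V} (hx : dep x + n < r) :
    1 / (D : ℝ) ≤ gainTransform par w P b n x := by
  have hC := hT.card_children_lt hdeg (x := x) (by omega)
  obtain ⟨D, rfl⟩ : ∃ D', D = D' + 1 := ⟨D - 1, by omega⟩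
  push_cast
  cases n with
  | zero =>
    cases b
    · have : gainTransform par w P false 0 x = 1 := by simp [gainTransform, gainBound]
      rw [this, div_le_one (by positivity)]
      linarith [Nat.cast_nonneg (α := ℝ) D]
    · rw [gainTransform_zero_true hT hw hind hlaw (by omega)]
      exact one_div_le_laplaceStep (by omega) (by simp)
  | succ n =>
    rw [gainTransform_succ hT hw hind hlaw b hx]
    refine one_div_le_laplaceStep (by omega) fun y hy => gainTransform_le_one hT hw _ ?_
    rw [hT.dep_of_mem_children (by omega) hy]; omega

/-- Level `n + 1` is essential: at level 0 the lower bound is 0 and its transform is 1 even when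
children exist. This costs one generation of contraction. -/
theorem gainTransform_le_of_children_nonempty (hT : IsRootedAt G par dep r u v)
    (hw : ∀ f, Measurable (w f)) (hind : iIndepFun w P) (hlaw : ∀ f, P.map (w f) = expMeasure 1)
    {D : ℕ} (hdeg : ∀ v : V, G.degree v ≤ D) (b : Bool) {n : ℕ} {x : V} (hx : dep x + (n + 1) < r)
    (hC : (children (G := G) par x).Nonempty) :
    gainTransform par w P b (n + 1) x ≤ 1 - 1 / (2 * D) := by
  obtain ⟨y, hy⟩ := hC
  have hd : ∀ y ∈ children (G := G) par x, dep y + n < r := fun y hy => by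
    rw [hT.dep_of_mem_children (by omega) hy]; omega
  rw [gainTransform_succ hT hw hind hlaw b hx]
  refine (laplaceStep_le_of_mem hy (fun _ _ => gainTransform_nonneg _ _ _)
    fun z hz => gainTransform_le_one hT hw _ (hd z hz)).trans ?_
  have := one_div_le_gainTransform hT hw hind hlaw hdeg (!b) (hd y hy)
  have h2 : 1 / (2 * (D : ℝ)) = 1 / D / 2 := by rw [div_div, mul_comm]
  rw [h2]
  linarith

/-- The lower and upper transforms approach each other geometrically. -/
theorem gainTransform_contraction (hT : IsRootedAt G par dep r u v)
    (hw : ∀ f, Measurable (w f)) (hind : iIndepFun w P) (hlaw : ∀ f, P.map (w f) = expMeasure 1)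
    {D : ℕ} (hdeg : ∀ v : V, G.degree v ≤ D) (k : ℕ) : ∀ x : V, dep x + (k + 1) < r →
    (1 - (1 - ((2 * (D : ℝ)) ^ D)⁻¹) ^ k) * gainTransform par w P false (k + 1) x
      ≤ gainTransform par w P true (k + 1) x := by
  classical
  induction k with
  | zero => intro x hx; simpa using gainTransform_nonneg true 1 x
  | succ k ih =>
    intro x hx
    have hcard := hT.card_children_lt hdeg (x := x) (by omega)
    have hD : (1 : ℝ) ≤ D := by exact_mod_cast (by omega : 1 ≤ D)
    set c := ((2 * (D : ℝ)) ^ D)⁻¹ with hc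
    have hc0 : 0 ≤ c := by positivity
    have hc1 : c ≤ 1 := inv_le_one_of_one_le₀ (one_le_pow₀ (by linarith))
    have hκ0 : 0 ≤ (1 - c) ^ k := pow_nonneg (by linarith) k
    set C := children (G := G) par x with hC
    -- The floor 1/D is available because transforms lie between 1/D and 1; it keeps `t` away from
    -- 0, as the leaf case requires.
    set t := max (1 - (1 - c) ^ k) (1 / (D : ℝ)) with ht
    have ht0 : 0 ≤ t := le_max_of_le_right (by positivity)
    have ht1 : t ≤ 1 := max_le (by linarith) (by rw [div_le_one (by linarith)]; exact hD)
    have htk : 1 - t ≤ (1 - c) ^ k := by linarith [le_max_left (1 - (1 - c) ^ k) (1 / (D : ℝ))]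
    have htD : 1 / (D : ℝ) ≤ t := le_max_right _ _
    have hd : ∀ y ∈ C, dep y + (k + 1) < r := fun y hy => by
      rw [hT.dep_of_mem_children (by omega) hy]; omega
    -- The transform reverses order: `lo` comes from the upper bound (`true`) and `hi` from the
    -- lower one.
    set lo := gainTransform par w P true (k + 1) with hlo
    set hi := gainTransform par w P false (k + 1) with hhi
    have hi0 : ∀ y ∈ C, 0 ≤ hi y := fun y _ => gainTransform_nonneg _ _ _
    have hi1 : ∀ y ∈ C, hi y ≤ 1 := fun y hy => gainTransform_le_one hT hw _ (hd y hy)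
    have lo1 : ∀ y ∈ C, lo y ≤ 1 := fun y hy => gainTransform_le_one hT hw _ (hd y hy)
    have hlohi : ∀ y ∈ C, t * hi y ≤ lo y := by
      intro y hy
      rw [ht, max_mul_of_nonneg _ _ (hi0 y hy)]
      refine max_le (ih y (hd y hy)) (le_trans ?_
        (one_div_le_gainTransform hT hw hind hlaw hdeg true (hd y hy)))
      exact mul_le_of_le_one_right (by positivity) (hi1 y hy)
    rw [gainTransform_succ hT hw hind hlaw false hx, gainTransform_succ hT hw hind hlaw true hx]
    change (1 - (1 - c) ^ (k + 1)) * laplaceStep C lo ≤ laplaceStep C hi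
    have hlo_nonneg : 0 ≤ laplaceStep C lo :=
      le_trans (by positivity) (one_div_le_laplaceStep (n := C.card) le_rfl lo1)
    -- Equivalently (1 - t)(1 - c) ≤ (1 - c)^(k+1).
    have hrate : 1 - (1 - c) ^ (k + 1) ≤ t + (1 - t) * c := by
      rw [pow_succ]
      nlinarith
    -- A single leaf child makes ∏ (1 - hi y) vanish; its coordinate is then frozen at 1 while the
    -- others are scaled. Without leaves, every `hi y` is at most 1 - 1/(2D).
    by_cases hleaf : ∃ j ∈ C, children (G := G) par j = ∅
    · obtain ⟨j, hj, hje⟩ := hleaf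
      have hcpos : 0 < C.card := Finset.card_pos.2 ⟨j, hj⟩
      obtain ⟨n, hn⟩ : ∃ n, D = n + 2 := ⟨D - 2, by omega⟩
      have h1 := laplaceStep_contraction_of_mem (n := n) hj (by omega) ht0 ht1 hi0 hi1
        (gainTransform_eq_one_of_children_eq_empty hje _ _)
      have hloj : lo j = 1 := gainTransform_eq_one_of_children_eq_empty hje _ _
      have h2 : laplaceStep C lo ≤ laplaceStep C (Function.update (t • hi) j 1) := by
        refine laplaceStep_anti (fun y hy => ?_) lo1
        by_cases hyj : y = j
        · subst hyj; simp [hloj]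
        · rw [Function.update_of_ne hyj]; exact hlohi y hy
      have h3 : c ≤ t / (((n : ℝ) + 1) * (n + 2)) := by
        have h4 := two_mul_pow_inv_le (n := n)
        have hDn : (D : ℝ) = n + 2 := by rw [hn]; push_cast; ring
        rw [hc, hDn, hn]
        refine h4.trans ?_
        rw [hDn] at htD
        gcongr
      refine le_trans ?_ h1
      refine mul_le_mul (hrate.trans ?_) h2 hlo_nonneg
        (add_nonneg ht0 (mul_nonneg (by linarith) (by positivity)))
      have := mul_le_mul_of_nonneg_left h3 (by linarith : 0 ≤ 1 - t)
      linarith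
    · push Not at hleaf
      have hprod : c ≤ ∏ y ∈ C, (1 - hi y) := by
        refine two_mul_pow_inv_le_prod (by omega) (by omega) fun y hy => ?_
        exact gainTransform_le_of_children_nonempty hT hw hind hlaw hdeg false (hd y hy)
          (Finset.nonempty_iff_ne_empty.2 (by simpa [Finset.nonempty_iff_ne_empty] using hleaf y hy))
      have h1 := laplaceStep_contraction ht0 ht1 hi0 hi1 hc0 hprod
      have h2 : laplaceStep C lo ≤ laplaceStep C fun y => t * hi y := laplaceStep_anti hlohi lo1
      refine le_trans ?_ h1
      exact mul_le_mul hrate h2 hlo_nonneg (add_nonneg ht0 (mul_nonneg (by linarith) hc0))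

/-- The probability that the weight of the root edge falls into the window left undecided by the
lower and upper bounds. -/
theorem measureReal_window_le (hT : IsRootedAt G par dep r u v)
    (hw : ∀ f, Measurable (w f)) (hind : iIndepFun w P) (hlaw : ∀ f, P.map (w f) = expMeasure 1)
    {D : ℕ} (hdeg : ∀ v : V, G.degree v ≤ D) (k : ℕ) (hk : k + 1 < r) :
    P.real {ω | (gainBound par (fun f => w f ω) false (k + 1) u
          + gainBound par (fun f => w f ω) false (k + 1) v : ℝ) ≤ w ⟨s(u, v), hT.adj⟩ ω ∧
        w ⟨s(u, v), hT.adj⟩ ω < (gainBound par (fun f => w f ω) true (k + 1) u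
          + gainBound par (fun f => w f ω) true (k + 1) v : ℝ)}
      ≤ 2 * (1 - ((2 * (D : ℝ)) ^ D)⁻¹) ^ k := by
  have hD : (1 : ℝ) ≤ D := by
    have := hT.card_children_lt hdeg (x := u) (by have := hT.dep_left; omega)
    exact_mod_cast (by omega : 1 ≤ D)
  have hdu : dep u + (k + 1) < r := by rw [hT.dep_left]; omega
  have hdv : dep v + (k + 1) < r := by rw [hT.dep_right]; omega
  set X := w ⟨s(u, v), hT.adj⟩ with hX
  set Z : Bool → Ω → ℝ := fun b ω => (gainBound par (fun f => w f ω) b (k + 1) u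
    + gainBound par (fun f => w f ω) b (k + 1) v : ℝ) with hZ
  have hZ0 : ∀ b ω, 0 ≤ Z b ω := fun b ω => add_nonneg (NNReal.coe_nonneg _) (NNReal.coe_nonneg _)
  have hmu := fun b => measurable_gainBound_of_measurable hT hw b hdu
  have hmv := fun b => measurable_gainBound_of_measurable hT hw b hdv
  have hZm : ∀ b, Measurable (Z b) := fun b =>
    (measurable_coe_nnreal_real.comp (hmu b)).add (measurable_coe_nnreal_real.comp (hmv b))
  have hXZ : ∀ b, IndepFun X (Z b) P := by
    intro b
    refine indepFun_of_sigmaOf hw hind (F := {⟨s(u, v), hT.adj⟩})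
      (F' := edgesBelowChildren G par dep u ∪ edgesBelowChildren G par dep v) ?_
      (measurable_sigmaOf w rfl) ?_
    · simp only [Set.disjoint_singleton_left, Set.mem_union, edgesBelowChildren, Set.mem_iUnion₂,
        not_or, not_exists]
      exact ⟨fun y _ => hT.root_notMem_edgesBelow y, fun y _ => hT.root_notMem_edgesBelow y⟩
    · have h1 := (measurable_gainBound_sigmaOf hT w b hdu).mono
        (sigmaOf_mono w (Set.subset_union_left (t := edgesBelowChildren G par dep v))) le_rfl
      have h2 := (measurable_gainBound_sigmaOf hT w b hdv).mono
        (sigmaOf_mono w (Set.subset_union_right (s := edgesBelowChildren G par dep u))) le_rfl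
      exact Measurable.add (measurable_coe_nnreal_real.comp h1) (measurable_coe_nnreal_real.comp h2)
  have hprod : ∀ b, ∫ ω, Real.exp (-Z b ω) ∂P
      = gainTransform par w P b (k + 1) u * gainTransform par w P b (k + 1) v := by
    intro b
    have hd : Disjoint (edgesBelowChildren G par dep u) (edgesBelowChildren G par dep v) := by
      have hsub : ∀ x, dep x = 0 → edgesBelowChildren G par dep x ⊆ edgesBelow G par dep x :=
        fun x hx => Set.iUnion₂_subset fun z hz => hT.edgesBelow_subset (by omega) hz
      exact (disjoint_edgesBelow hT.adj.ne (by rw [hT.dep_left, hT.dep_right])).mono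
        (hsub u hT.dep_left) (hsub v hT.dep_right)
    have hI : IndepFun (fun ω => gainBound par (fun f => w f ω) b (k + 1) u)
        (fun ω => gainBound par (fun f => w f ω) b (k + 1) v) P :=
      indepFun_of_sigmaOf hw hind hd (measurable_gainBound_sigmaOf hT w b hdu)
        (measurable_gainBound_sigmaOf hT w b hdv)
    have hφ : Measurable fun y : ℝ≥0 => Real.exp (-(y : ℝ)) := by fun_prop
    have := (hI.comp hφ hφ).integral_mul_eq_mul_integral
      (hφ.comp (hmu b)).aestronglyMeasurable (hφ.comp (hmv b)).aestronglyMeasurable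
    simp only [hZ, neg_add, Real.exp_add]
    exact this
  have : NullSingletonClass (P.map X) := by
    rw [hlaw, expMeasure, gammaMeasure]; infer_instance
  have hnull : P.real {ω | X ω = Z false ω} = 0 := by
    rw [Measure.real, measure_eq_of_indepFun_eq_zero (hw _) (hZm _) (hXZ _)]; simp
  set c := ((2 * (D : ℝ)) ^ D)⁻¹ with hc
  have hc0 : 0 ≤ c := by positivity
  have hc1 : c ≤ 1 := inv_le_one_of_one_le₀ (one_le_pow₀ (by linarith))
  have hκ0 : 0 ≤ (1 - c) ^ k := pow_nonneg (by linarith) k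
  have hκ1 : (1 - c) ^ k ≤ 1 := pow_le_one₀ (by linarith) (by linarith)
  have hcu := gainTransform_contraction hT hw hind hlaw hdeg k u hdu
  have hcv := gainTransform_contraction hT hw hind hlaw hdeg k v hdv
  have hu0 := gainTransform_nonneg (par := par) (w := w) (P := P) false (k + 1) u
  have hv0 := gainTransform_nonneg (par := par) (w := w) (P := P) false (k + 1) v
  have hu1 := gainTransform_le_one (P := P) hT hw false hdu
  have hv1 := gainTransform_le_one (P := P) hT hw false hdv
  have hle : ∀ b, P.real {ω | X ω ≤ Z b ω}
      = 1 - gainTransform par w P b (k + 1) u * gainTransform par w P b (k + 1) v := fun b => by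
    rw [measureReal_le_of_indepFun (hw _) (hZm b) (hXZ b) (hlaw _) (hZ0 b), hprod]
  -- The window contains its left endpoint; this tie is null because the weight is atomless and
  -- independent of the bound.
  have hfin : P.real {ω | Z false ω ≤ X ω ∧ X ω < Z true ω}
      ≤ P.real ({ω | X ω ≤ Z true ω} \ {ω | X ω ≤ Z false ω}) + P.real {ω | X ω = Z false ω} := by
    refine (measureReal_mono ?_).trans (measureReal_union_le _ _)
    rintro ω ⟨h1, h2⟩
    rcases h1.eq_or_lt with h | h
    · exact Or.inr h.symm
    · exact Or.inl ⟨h2.le, not_le.2 h⟩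
  have hdiff : P.real ({ω | X ω ≤ Z true ω} \ {ω | X ω ≤ Z false ω})
      ≤ gainTransform par w P false (k + 1) u * gainTransform par w P false (k + 1) v
        - gainTransform par w P true (k + 1) u * gainTransform par w P true (k + 1) v := by
    have hsub : {ω | X ω ≤ Z false ω} ⊆ {ω | X ω ≤ Z true ω} := fun ω (h : X ω ≤ Z false ω) =>
      h.trans (add_le_add (NNReal.coe_le_coe.2 (gainBound_false_le_true _ _ _ _))
        (NNReal.coe_le_coe.2 (gainBound_false_le_true _ _ _ _)))
    rw [measureReal_sdiff hsub (measurableSet_le (hw _) (hZm _)), hle, hle]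
    linarith
  rw [hnull, add_zero] at hfin
  refine (hfin.trans hdiff).trans ?_
  -- With κ = (1 - c)^k, the product of the smaller transforms is at least (1 - κ)² times that of
  -- the larger ones, so the difference is at most 2κ - κ² ≤ 2κ.
  have h1 := mul_le_mul hcu hcv (mul_nonneg (by linarith) hv0) (gainTransform_nonneg _ _ _)
  have hS0 := mul_nonneg hu0 hv0
  have hS1 := mul_le_one₀ hu1 hv0 hv1
  rw [← hc, mul_mul_mul_comm] at h1
  nlinarith [mul_le_mul_of_nonneg_left hS1 hκ0, mul_nonneg hS0 (mul_nonneg hκ0 hκ0)]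

end Measurability


/-! ### Depth in the graph, and the rooted structure of a ball that is a tree. -/

/-- The distance of a vertex to the nearer of the two vertices `u` and `v`. -/
noncomputable def depth (G : SimpleGraph V) (u v z : V) : ℕ :=
  min (G.dist u z) (G.dist v z)

section Depth

variable (hconn : G.Connected) {u v : V}
include hconn

theorem depth_eq_zero {z : V} (h : depth G u v z = 0) : z = u ∨ z = v := by
  rcases Nat.min_eq_zero_iff.1 h with h | h
  · exact Or.inl ((hconn.dist_eq_zero_iff).1 h).symm
  · exact Or.inr ((hconn.dist_eq_zero_iff).1 h).symm

theorem depth_le_of_adj {x y : V} (h : G.Adj x y) : depth G u v y ≤ depth G u v x + 1 := by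
  have h1 : G.dist x y = 1 := SimpleGraph.dist_eq_one_iff_adj.2 h
  have h2 := hconn.dist_triangle (u := u) (v := x) (w := y)
  have h3 := hconn.dist_triangle (u := v) (v := x) (w := y)
  unfold depth
  omega

theorem exists_adj_dist_add_one {x z : V} (h : G.dist x z ≠ 0) :
    ∃ p, G.Adj z p ∧ G.dist x p + 1 ≤ G.dist x z := by
  obtain ⟨W, hW⟩ := (hconn z x).exists_walk_length_eq_dist
  rw [SimpleGraph.dist_comm] at hW
  cases W with
  | nil => exact absurd SimpleGraph.dist_self h
  | cons hadj W' =>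
    refine ⟨_, hadj, ?_⟩
    rw [SimpleGraph.Walk.length_cons] at hW
    have := SimpleGraph.dist_le W'
    rw [SimpleGraph.dist_comm] at this
    omega

theorem exists_adj_depth_add_one {z : V} (h : depth G u v z ≠ 0) :
    ∃ p, G.Adj z p ∧ depth G u v p + 1 = depth G u v z := by
  have : ∃ p, G.Adj z p ∧ depth G u v p + 1 ≤ depth G u v z := by
    unfold depth at h ⊢
    rcases le_total (G.dist u z) (G.dist v z) with hle | hle
    · obtain ⟨p, hp, hd⟩ := exists_adj_dist_add_one hconn (x := u) (z := z) (by omega)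
      exact ⟨p, hp, by omega⟩
    · obtain ⟨p, hp, hd⟩ := exists_adj_dist_add_one hconn (x := v) (z := z) (by omega)
      exact ⟨p, hp, by omega⟩
  obtain ⟨p, hp, hd⟩ := this
  have := depth_le_of_adj hconn (u := u) (v := v) hp.symm
  exact ⟨p, hp, by omega⟩

theorem finite_depth_le [G.LocallyFinite] (u v : V) (n : ℕ) : {z | depth G u v z ≤ n}.Finite := by
  induction n with
  | zero =>
    refine (Set.toFinite {u, v}).subset fun z hz => ?_
    simpa using depth_eq_zero hconn (Nat.le_zero.1 hz)
  | succ n ih =>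
    refine (ih.union (ih.biUnion fun x _ => (G.neighborFinset x).finite_toSet)).subset fun z hz => ?_
    by_cases h0 : depth G u v z = 0
    · exact Or.inl (by simp [h0])
    · obtain ⟨p, hp, hd⟩ := exists_adj_depth_add_one hconn h0
      refine Or.inr (Set.mem_iUnion₂.2 ⟨p, ?_, by simpa using hp.symm⟩)
      have : depth G u v z ≤ n + 1 := hz
      show depth G u v p ≤ n
      omega

theorem mem_verts_edgeBall {h : G.Adj u v} {r : ℕ} {z : V} :
    z ∈ (edgeBall G ⟨s(u, v), h⟩ r).verts ↔ depth G u v z ≤ r := by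
  have : ∀ y, G.edist y z ≤ (r : ℕ∞) ↔ G.dist y z ≤ r := fun y => by
    rw [← (hconn y z).coe_dist_eq_edist, Nat.cast_le]
  simp [edgeBall, depth, this]

theorem edgeBall_adj {h : G.Adj u v} {r : ℕ} {x y : V} (hx : depth G u v x ≤ r)
    (hy : depth G u v y ≤ r) (hxy : G.Adj x y) : (edgeBall G ⟨s(u, v), h⟩ r).Adj x y :=
  ⟨(mem_verts_edgeBall hconn (h := h)).2 hx, (mem_verts_edgeBall hconn (h := h)).2 hy, hxy⟩

theorem le_depth_of_mem_boundary {h : G.Adj u v} {r : ℕ} {z : V}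
    (hz : z ∈ boundary (edgeBall G ⟨s(u, v), h⟩ r)) : r ≤ depth G u v z := by
  obtain ⟨-, y, hy, hzy⟩ := hz
  rw [mem_verts_edgeBall hconn] at hy
  have := depth_le_of_adj hconn (u := u) (v := v) hzy
  omega

/-- In a ball which is a tree, a vertex has only one neighbour that is not farther from the root
edge. -/
theorem eq_of_adj_of_depth_le (huv : G.Adj u v) {r : ℕ}
    (htree : (edgeBall G ⟨s(u, v), huv⟩ r).coe.IsTree) {x p q : V} (hx0 : depth G u v x ≠ 0)
    (hxr : depth G u v x ≤ r) (hp : G.Adj x p) (hpd : depth G u v p ≤ depth G u v x)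
    (hq : G.Adj x q) (hqd : depth G u v q ≤ depth G u v x) : p = q := by
  by_contra hpq
  have hmem {z : V} (hz : depth G u v z ≤ r) : z ∈ (edgeBall G ⟨s(u, v), huv⟩ r).verts :=
    (mem_verts_edgeBall hconn).2 hz
  set K := (edgeBall G ⟨s(u, v), huv⟩ r).coe with hK
  have hadj {y z : V} (hy : depth G u v y ≤ r) (hz : depth G u v z ≤ r) (hyz : G.Adj y z) :
      K.Adj ⟨y, hmem hy⟩ ⟨z, hmem hz⟩ := edgeBall_adj hconn hy hz hyz
  -- In a tree the edge xp is a bridge; a second neighbour q that is no deeper than x would give a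
  -- detour x, q, ..., u, ..., p avoiding it.
  have hbr := SimpleGraph.isAcyclic_iff_forall_adj_isBridge.1 htree.isAcyclic
    (hadj hxr (hpd.trans hxr) hp)
  rw [SimpleGraph.isBridge_iff] at hbr
  set K' := K.deleteEdges {s(⟨x, hmem hxr⟩, ⟨p, hmem (hpd.trans hxr)⟩)} with hK'
  have hadj' {y z : V} (hy : depth G u v y ≤ r) (hz : depth G u v z ≤ r) (hyz : G.Adj y z)
      (hyx : y ≠ x) (hzx : z ≠ x) : K'.Adj ⟨y, hmem hy⟩ ⟨z, hmem hz⟩ := by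
    rw [hK', SimpleGraph.deleteEdges_adj]
    refine ⟨hadj hy hz hyz, ?_⟩
    simp only [Set.mem_singleton_iff, Sym2.eq_iff, Subtype.mk.injEq]
    tauto
  have hu0 : depth G u v u = 0 := by simp [depth]
  have hv0 : depth G u v v = 0 := by simp [depth]
  -- A descent by depth from a vertex other than x of depth at most that of x never meets x, since
  -- every later vertex has strictly smaller depth; at depth 0 the edge uv finishes the path.
  have hreach : ∀ (k : ℕ) (z : V) (hz : depth G u v z ≤ r), depth G u v z = k →
      k ≤ depth G u v x → z ≠ x → K'.Reachable ⟨z, hmem hz⟩ ⟨u, hmem (by omega)⟩ := by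
    intro k
    induction k with
    | zero =>
      intro z hz hz0 _ hzx
      rcases depth_eq_zero hconn hz0 with rfl | rfl
      · exact SimpleGraph.Reachable.refl _
      · exact (hadj' hz (by omega) huv.symm hzx (by rintro rfl; omega)).reachable
    | succ k ih =>
      intro z hz hzk hk hzx
      obtain ⟨y, hy, hd⟩ := exists_adj_depth_add_one hconn (u := u) (v := v) (z := z) (by omega)
      have hyx : y ≠ x := by rintro rfl; omega
      exact (hadj' hz (by omega) hy hzx hyx).reachable.trans
        (ih y (by omega) (by omega) (by omega) hyx)
  have h1 := hreach _ p (hpd.trans hxr) rfl hpd hp.ne'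
  have h2 := hreach _ q (hqd.trans hxr) rfl hqd hq.ne'
  have h3 : K'.Adj ⟨x, hmem hxr⟩ ⟨q, hmem (hqd.trans hxr)⟩ := by
    rw [hK', SimpleGraph.deleteEdges_adj]
    refine ⟨hadj hxr (hqd.trans hxr) hq, ?_⟩
    simp only [Set.mem_singleton_iff, Sym2.eq_iff, Subtype.mk.injEq]
    rintro (⟨-, h⟩ | ⟨h, -⟩)
    · exact hpq h.symm
    · exact hp.ne h
  exact hbr (h3.reachable.trans (h2.trans h1.symm))

/-- A ball around the edge `uv` which is a tree is rooted at `uv`. -/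
theorem exists_isRootedAt (huv : G.Adj u v) {r : ℕ}
    (htree : (edgeBall G ⟨s(u, v), huv⟩ r).coe.IsTree) :
    ∃ par : V → V, IsRootedAt G par (depth G u v) r u v := by
  classical
  have hpred : ∀ z, ∃ p, depth G u v z ≠ 0 → G.Adj z p ∧ depth G u v p + 1 = depth G u v z := by
    intro z
    by_cases h : depth G u v z = 0
    · exact ⟨z, fun h' => absurd h h'⟩
    · obtain ⟨p, hp⟩ := exists_adj_depth_add_one hconn h
      exact ⟨p, fun _ => hp⟩
  choose pred hpred using hpred
  have hu0 : depth G u v u = 0 := by simp [depth]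
  have hv0 : depth G u v v = 0 := by simp [depth]
  set par : V → V := fun z => if z = u then v else if z = v then u else pred z with hpar
  have hpu : par u = v := by simp [hpar]
  have hpv : par v = u := by simp [hpar, huv.ne']
  have hpz : ∀ z, depth G u v z ≠ 0 → par z = pred z := by
    intro z hz
    have h1 : z ≠ u := by rintro rfl; exact hz hu0
    have h2 : z ≠ v := by rintro rfl; exact hz hv0
    simp [hpar, h1, h2]
  have hchild : ∀ x y, depth G u v x < r → G.Adj x y → y ≠ par x →
      depth G u v y = depth G u v x + 1 := by
    intro x y hx hxy hy
    have hle := depth_le_of_adj hconn (u := u) (v := v) hxy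
    by_contra hne
    have hyx : depth G u v y ≤ depth G u v x := by omega
    by_cases h0 : depth G u v x = 0
    · have hy0 : depth G u v y = 0 := by omega
      rcases depth_eq_zero hconn h0 with rfl | rfl <;>
        rcases depth_eq_zero hconn hy0 with rfl | rfl
      · exact hxy.ne rfl
      · exact hy hpu.symm
      · exact hy hpv.symm
      · exact hxy.ne rfl
    · obtain ⟨h1, h2⟩ := hpred x h0
      rw [hpz x h0] at hy
      exact hy (eq_of_adj_of_depth_le hconn huv htree h0 hx.le hxy hyx h1 (by omega))
  refine ⟨par, huv, hu0, hv0, hpu, hpv, ?_, hchild, ?_⟩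
  · intro x hx
    by_cases h0 : depth G u v x = 0
    · rcases depth_eq_zero hconn h0 with rfl | rfl
      · rw [hpu]; exact huv
      · rw [hpv]; exact huv.symm
    · rw [hpz x h0]; exact (hpred x h0).1
  · intro x y hx hxy hy
    have hd := hchild x y hx hxy hy
    have h0 : depth G u v y ≠ 0 := by omega
    obtain ⟨h1, h2⟩ := hpred y h0
    rw [hpz y h0]
    exact eq_of_adj_of_depth_le hconn huv htree h0 (by omega) h1 (by omega) hxy.symm (by omega)

end Depth

/-! ### Almost sure uniqueness, measurability and integrability. -/

theorem isMatchingOf_deleteVerts_edgeBall {e : G.edgeSet} {r : ℕ} {A : Set V}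
    {M : Finset G.edgeSet} : IsMatchingOf ((edgeBall G e r).deleteVerts A) M ↔
      IsMatchingIn ((edgeBall G e r).verts \ A) M := by
  refine and_congr (forall₂_congr fun f _ => ?_) Iff.rfl
  obtain ⟨f, hf⟩ := f
  induction f with
  | h x y =>
    have hxy : G.Adj x y := hf
    simp only [SimpleGraph.Subgraph.mem_edgeSet, edgeBall,
      SimpleGraph.Subgraph.induce_adj, SimpleGraph.Subgraph.induce_verts,
      SimpleGraph.Subgraph.top_adj, Sym2.mem_iff, forall_eq_or_imp, forall_eq, Set.mem_sdiff]
    tauto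

theorem isMaxWeightMatching_deleteVerts_edgeBall {w : G.edgeSet → ℝ} {e : G.edgeSet} {r : ℕ}
    (hfin : (edgeBall G e r).verts.Finite) {A : Set V} {M : Finset G.edgeSet} :
    IsMaxWeightMatching w ((edgeBall G e r).deleteVerts A) M ↔
      IsMatchingIn ((edgeBall G e r).verts \ A) M ∧
        weight w M = maxWeight w ((edgeBall G e r).verts \ A) := by
  have hS : ((edgeBall G e r).verts \ A).Finite := hfin.sdiff
  simp only [IsMaxWeightMatching, isMatchingOf_deleteVerts_edgeBall]
  refine and_congr_right fun hM => ⟨fun h => ?_, fun h M' hM' => h ▸ weight_le_maxWeight w hS hM'⟩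
  obtain ⟨N, hN, hw⟩ := exists_weight_eq_maxWeight w hS
  exact le_antisymm (weight_le_maxWeight w hS hM) (hw ▸ h N hN)

/-- Almost surely, distinct matchings inside a finite set have distinct weights. -/
theorem ae_weight_injOn {Ω : Type*} [MeasurableSpace Ω] {P : Measure Ω} [IsProbabilityMeasure P]
    {w : G.edgeSet → Ω → ℝ} (hw : ∀ f, Measurable (w f)) (hind : iIndepFun w P)
    (hlaw : ∀ f, P.map (w f) = expMeasure 1) {S : Set V} (hS : S.Finite) :
    ∀ᵐ ω ∂P, Set.InjOn (weight fun f => w f ω) {M : Finset G.edgeSet | IsMatchingIn S M} := by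
  classical
  -- Equal weights would express `w f` through the weights of other edges, of which it is
  -- independent, and the law of `w f` has no atoms.
  have key : ∀ M M' : Finset G.edgeSet, ∀ f ∈ M, f ∉ M' →
      ∀ᵐ ω ∂P, weight (fun f => w f ω) M ≠ weight (fun f => w f ω) M' := by
    intro M M' f hf hf'
    have : NullSingletonClass (P.map (w f)) := by
      rw [hlaw, expMeasure, gammaMeasure]; infer_instance
    have hsum : ∀ N : Finset G.edgeSet, f ∉ N →
        Measurable[sigmaOf w {f}ᶜ] fun ω => ∑ g ∈ N, w g ω := fun N hN =>
      Finset.measurable_sum N fun g hg => measurable_sigmaOf w (by rintro rfl; exact hN hg)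
    have hY : Measurable[sigmaOf w {f}ᶜ] fun ω => ∑ g ∈ M', w g ω - ∑ g ∈ M.erase f, w g ω :=
      (hsum M' hf').sub (hsum _ (Finset.notMem_erase f M))
    have h0 := measure_eq_of_indepFun_eq_zero (P := P) (hw f)
      (hY.mono (sigmaOf_le hw _) le_rfl)
      (indepFun_of_sigmaOf hw hind (F := {f}) disjoint_compl_right
        (measurable_sigmaOf w rfl) hY)
    refine measure_mono_null (fun ω hω => ?_) h0
    have hω' : weight (fun f => w f ω) M = weight (fun f => w f ω) M' := not_not.1 hω
    rw [weight, weight, ← Finset.add_sum_erase _ _ hf] at hω'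
    show w f ω = _
    linarith
  have hfin := finite_matchings (G := G) hS
  have : ∀ᵐ ω ∂P, ∀ M ∈ {M : Finset G.edgeSet | IsMatchingIn S M},
      ∀ M' ∈ {M : Finset G.edgeSet | IsMatchingIn S M}, M ≠ M' →
        weight (fun f => w f ω) M ≠ weight (fun f => w f ω) M' := by
    rw [ae_ball_iff hfin.countable]
    intro M _
    rw [ae_ball_iff hfin.countable]
    intro M' _
    by_cases hMM : M = M'
    · exact ae_of_all _ fun ω h => absurd hMM h
    · have : ∃ f, ¬ (f ∈ M ↔ f ∈ M') := by
        by_contra! h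
        exact hMM (Finset.ext h)
      obtain ⟨f, hf⟩ := this
      by_cases hfM : f ∈ M
      · filter_upwards [key M M' f hfM (by tauto)] with ω h _ using h
      · filter_upwards [key M' M f (by tauto) hfM] with ω h _ using h.symm
  filter_upwards [this] with ω h M hM M' hM' heq
  by_contra hne
  exact h M hM M' hM' hne heq

section Influence

variable {e : G.edgeSet} {r : ℕ}

/-- Matchings of the smaller graphs are matchings of the ball, so injectivity of the weight on the
ball settles all `A` on one event. -/
theorem existsUnique_isMaxWeightMatching {w : G.edgeSet → ℝ}
    (hfin : (edgeBall G e r).verts.Finite)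
    (hinj : Set.InjOn (weight w) {M : Finset G.edgeSet | IsMatchingIn (edgeBall G e r).verts M})
    (A : Set V) : ∃! M, IsMaxWeightMatching w ((edgeBall G e r).deleteVerts A) M := by
  simp only [isMaxWeightMatching_deleteVerts_edgeBall hfin]
  obtain ⟨M, hM, hw⟩ := exists_weight_eq_maxWeight w (hfin.sdiff (t := A))
  exact ⟨M, ⟨hM, hw⟩, fun N hN => hinj (hN.1.mono Set.sdiff_subset) (hM.mono Set.sdiff_subset)
    (hN.2.trans hw.symm)⟩

theorem matchedIndicator_eq {w : G.edgeSet → ℝ} {H : G.Subgraph} {M : Finset G.edgeSet}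
    (hM : IsMaxWeightMatching w H M) (huniq : ∀ N, IsMaxWeightMatching w H N → N = M)
    (f : G.edgeSet) : matchedIndicator w H f = Set.indicator (M : Set G.edgeSet) (fun _ => 1) f := by
  have : maxWeightMatching w H = M := huniq _ (Classical.epsilon_spec ⟨M, hM⟩)
  rw [matchedIndicator, this]

theorem abs_matchedIndicator_sub_le (w : G.edgeSet → ℝ) (H H' : G.Subgraph) (f : G.edgeSet) :
    |matchedIndicator w H f - matchedIndicator w H' f| ≤ 1 := by
  have h : ∀ H : G.Subgraph, 0 ≤ matchedIndicator w H f ∧ matchedIndicator w H f ≤ 1 := fun H =>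
    ⟨Set.indicator_nonneg (fun _ _ => zero_le_one) _,
      Set.indicator_le_self' (f := fun _ => (1 : ℝ)) (fun _ _ => zero_le_one) _⟩
  rw [abs_le]
  constructor <;> linarith [h H, h H']

theorem boundaryInfluence_nonneg (w : G.edgeSet → ℝ) : 0 ≤ boundaryInfluence w e r :=
  Real.iSup_nonneg fun _ => abs_nonneg _

theorem boundaryInfluence_le_one (w : G.edgeSet → ℝ) : boundaryInfluence w e r ≤ 1 :=
  Real.iSup_le (fun _ => abs_matchedIndicator_sub_le _ _ _ _) zero_le_one

variable {Ω : Type*} [MeasurableSpace Ω] {P : Measure Ω} {w : G.edgeSet → Ω → ℝ}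

/-- The arbitrary choice under ties need not be measurable in ω, but where the optimum is unique the
indicator is that of the event that some matching containing `e` dominates all others, a finite
combination of weight inequalities. -/
theorem aemeasurable_matchedIndicator (hw : ∀ f, Measurable (w f))
    (hfin : (edgeBall G e r).verts.Finite)
    (hinj : ∀ᵐ ω ∂P, Set.InjOn (weight fun f => w f ω)
      {M : Finset G.edgeSet | IsMatchingIn (edgeBall G e r).verts M}) (A : Set V) :
    AEMeasurable (fun ω =>
      matchedIndicator (fun f => w f ω) ((edgeBall G e r).deleteVerts A) e) P := by
  classical
  set S := (edgeBall G e r).verts \ A with hS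
  have hms := finite_matchings (G := G) (hfin.sdiff (t := A))
  have hwm : ∀ M : Finset G.edgeSet, Measurable fun ω => weight (fun f => w f ω) M := fun M =>
    Finset.measurable_sum M fun f _ => hw f
  set T : Set Ω := ⋃ M ∈ {M : Finset G.edgeSet | IsMatchingIn S M ∧ e ∈ M},
    ⋂ M' ∈ {M : Finset G.edgeSet | IsMatchingIn S M},
      {ω | weight (fun f => w f ω) M' ≤ weight (fun f => w f ω) M} with hT
  have hTm : MeasurableSet T :=
    (hms.subset fun _ h => h.1).measurableSet_biUnion fun M _ =>
      hms.measurableSet_biInter fun M' _ => measurableSet_le (hwm M') (hwm M)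
  refine ⟨T.indicator fun _ => 1, measurable_const.indicator hTm, ?_⟩
  filter_upwards [hinj] with ω hω
  obtain ⟨M, hM, huniq⟩ := existsUnique_isMaxWeightMatching hfin hω A
  rw [matchedIndicator_eq hM huniq]
  have hiff : e ∈ (M : Set G.edgeSet) ↔ ω ∈ T := by
    simp only [hT, Set.mem_iUnion₂, Set.mem_iInter₂, Set.mem_ofPred_eq]
    constructor
    · intro he
      exact ⟨M, ⟨isMatchingOf_deleteVerts_edgeBall.1 hM.1, he⟩,
        fun M' hM' => hM.2 M' (isMatchingOf_deleteVerts_edgeBall.2 hM')⟩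
    · rintro ⟨N, ⟨hN, he⟩, hNmax⟩
      rwa [← huniq N ⟨isMatchingOf_deleteVerts_edgeBall.2 hN,
        fun M' hM' => hNmax M' (isMatchingOf_deleteVerts_edgeBall.1 hM')⟩]
  simp only [Set.indicator_apply, hiff]

theorem integrable_boundaryInfluence [IsFiniteMeasure P] (hw : ∀ f, Measurable (w f))
    (hfin : (edgeBall G e r).verts.Finite)
    (hinj : ∀ᵐ ω ∂P, Set.InjOn (weight fun f => w f ω)
      {M : Finset G.edgeSet | IsMatchingIn (edgeBall G e r).verts M}) :
    Integrable (fun ω => boundaryInfluence (fun f => w f ω) e r) P := by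
  have hb : (boundary (edgeBall G e r)).Finite := hfin.subset fun _ h => h.1
  have : Finite {A : Set V // A ⊆ boundary (edgeBall G e r)} := hb.finite_subsets.to_subtype
  have hmeas : AEMeasurable (fun ω => boundaryInfluence (fun f => w f ω) e r) P := by
    refine AEMeasurable.iSup fun A => ?_
    have h0 := aemeasurable_matchedIndicator hw hfin hinj ∅
    rw [SimpleGraph.Subgraph.deleteVerts_empty] at h0
    exact (h0.sub (aemeasurable_matchedIndicator hw hfin hinj A)).abs
  refine Integrable.of_bound hmeas.aestronglyMeasurable 1 (ae_of_all _ fun ω => ?_)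
  rw [Real.norm_of_nonneg (boundaryInfluence_nonneg _)]
  exact boundaryInfluence_le_one _

end Influence

end MWM


/-! ### Assembly of the main theorem. -/

theorem theorem1 {V : Type*} (G : SimpleGraph V) [G.LocallyFinite] (hconn : G.Connected)
    (D : ℕ) (hdeg : ∀ v : V, G.degree v ≤ D)
    {Ω : Type*} [MeasurableSpace Ω] (P : Measure Ω) [IsProbabilityMeasure P]
    (w : G.edgeSet → Ω → ℝ) (hmeas : ∀ f, Measurable (w f))
    (hindep : iIndepFun w P) (hlaw : ∀ f, P.map (w f) = expMeasure 1)
    (e : G.edgeSet) (r : ℕ) (hr : 3 ≤ r) (htree : (MWM.edgeBall G e r).coe.IsTree) :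
    (∀ᵐ ω ∂P, ∀ A : Set V, A ⊆ MWM.boundary (MWM.edgeBall G e r) →
      ∃! M : Finset G.edgeSet,
        MWM.IsMaxWeightMatching (fun f => w f ω) ((MWM.edgeBall G e r).deleteVerts A) M) ∧
    Integrable (fun ω => MWM.boundaryInfluence (fun f => w f ω) e r) P ∧
    MWM.corrDecay P w e r ≤ 2 * (D : ℝ) * (1 - (2 * (D : ℝ)) ^ (-(D : ℤ))) ^ (r - 2) := by
  open MWM in
  obtain ⟨e, he⟩ := e
  induction e with
  | h u v =>
  have huv : G.Adj u v := he
  have hfin : (edgeBall G ⟨s(u, v), he⟩ r).verts.Finite :=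
    (finite_depth_le hconn u v r).subset fun z hz => (mem_verts_edgeBall hconn).1 hz
  have hinj := ae_weight_injOn hmeas hindep hlaw hfin
  have hint := integrable_boundaryInfluence hmeas hfin hinj
  refine ⟨?_, hint, ?_⟩
  · filter_upwards [hinj] with ω hω A _ using existsUnique_isMaxWeightMatching hfin hω A
  obtain ⟨par, hT⟩ := exists_isRootedAt hconn huv htree
  -- `r - 2` is the largest `k` with `k + 1 < r`.
  have hwin := measureReal_window_le hT hmeas hindep hlaw hdeg (r - 2) (by omega)
  set E := {ω | (gainBound par (fun f => w f ω) false (r - 2 + 1) u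
          + gainBound par (fun f => w f ω) false (r - 2 + 1) v : ℝ) ≤ w ⟨s(u, v), hT.adj⟩ ω ∧
        w ⟨s(u, v), hT.adj⟩ ω < (gainBound par (fun f => w f ω) true (r - 2 + 1) u
          + gainBound par (fun f => w f ω) true (r - 2 + 1) v : ℝ)} with hE
  have hEm : MeasurableSet E := by
    have hm : ∀ b, Measurable fun ω => (gainBound par (fun f => w f ω) b (r - 2 + 1) u
        + gainBound par (fun f => w f ω) b (r - 2 + 1) v : ℝ) := fun b =>
      (measurable_coe_nnreal_real.comp (measurable_gainBound_of_measurable hT hmeas b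
        (by rw [hT.dep_left]; omega))).add
      (measurable_coe_nnreal_real.comp (measurable_gainBound_of_measurable hT hmeas b
        (by rw [hT.dep_right]; omega)))
    exact (measurableSet_le (hm false) (hmeas _)).inter (measurableSet_lt (hmeas _) (hm true))
  have hle : ∀ᵐ ω ∂P, boundaryInfluence (fun f => w f ω) ⟨s(u, v), he⟩ r
      ≤ E.indicator (fun _ => (1 : ℝ)) ω := by
    filter_upwards [hinj] with ω hω
    by_cases hωE : ω ∈ E
    · rw [Set.indicator_of_mem hωE]; exact boundaryInfluence_le_one _
    rw [Set.indicator_of_notMem hωE]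
    -- Outside the window the indicator is decided by an expression that does not involve `A`, since
    -- boundary vertices have depth at least `r` and every vertex of smaller depth survives.
    have hval : ∀ A ⊆ boundary (edgeBall G ⟨s(u, v), he⟩ r),
        matchedIndicator (fun f => w f ω) ((edgeBall G ⟨s(u, v), he⟩ r).deleteVerts A) ⟨s(u, v), he⟩
          = if (gainBound par (fun f => w f ω) true (r - 2 + 1) u
            + gainBound par (fun f => w f ω) true (r - 2 + 1) v : ℝ) ≤ w ⟨s(u, v), hT.adj⟩ ω
            then 1 else 0 := by
      intro A hA
      obtain ⟨M, hM, huniq⟩ := existsUnique_isMaxWeightMatching hfin hω A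
      rw [matchedIndicator_eq hM huniq]
      rw [isMaxWeightMatching_deleteVerts_edgeBall hfin] at hM
      obtain ⟨hin, hout⟩ := edge_mem_of_gainBound hT.dep_left hT.dep_right hT.adj hT.par_left
        hT.par_right hT.dep_child hT.par_child (fun f => w f ω) (r - 2) (by omega)
        (hfin.sdiff (t := A))
        (fun z hz => ⟨(mem_verts_edgeBall hconn).2 hz.le, fun hzA =>
          absurd (le_depth_of_mem_boundary hconn (hA hzA)) (by omega)⟩) hM.1 hM.2
        (fun M' h1 h2 => huniq M' ((isMaxWeightMatching_deleteVerts_edgeBall hfin).2 ⟨h1, h2⟩))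
      split_ifs with hc
      · exact Set.indicator_of_mem (hin hc) _
      · refine Set.indicator_of_notMem (hout ?_) _
        by_contra hlt
        exact hωE ⟨not_lt.1 hlt, not_le.1 hc⟩
    refine Real.iSup_le (fun A => ?_) le_rfl
    have h0 := hval ∅ (Set.empty_subset _)
    rw [SimpleGraph.Subgraph.deleteVerts_empty] at h0
    rw [h0, hval A A.2, sub_self, abs_zero]
  have hD : (1 : ℝ) ≤ D := by
    have := hT.card_children_lt hdeg (x := u) (by have := hT.dep_left; omega)
    exact_mod_cast (by omega : 1 ≤ D)
  have hc1 : ((2 * (D : ℝ)) ^ D)⁻¹ ≤ 1 := inv_le_one_of_one_le₀ (one_le_pow₀ (by linarith))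
  have hκ0 : 0 ≤ (1 - ((2 * (D : ℝ)) ^ D)⁻¹) ^ (r - 2) := pow_nonneg (by linarith) _
  calc corrDecay P w ⟨s(u, v), he⟩ r ≤ ∫ ω, E.indicator (fun _ => (1 : ℝ)) ω ∂P :=
        integral_mono_ae hint ((integrable_const 1).indicator hEm) hle
    _ = P.real E := integral_indicator_one hEm
    _ ≤ 2 * (1 - ((2 * (D : ℝ)) ^ D)⁻¹) ^ (r - 2) := hwin
    -- The window bound has 2 in place of 2D, so only `1 ≤ D` is needed.
    _ ≤ 2 * (D : ℝ) * (1 - (2 * (D : ℝ)) ^ (-(D : ℤ))) ^ (r - 2) := by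
        rw [zpow_neg, zpow_natCast]
        gcongr
        linarith
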